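/- Conventions. All cardinal invariants (weight $w$, character $\chi$, pseudocharacter $\psi$, density $d$) are taken to be infinite, i.e. each is replaced by its maximum with $\aleph_0$. A Hausdorff topological group is *minimal* if it admits no strictly coarser Hausdorff group topology. A topological group is *Weil complete* if it is complete in its right uniformity, and *Raikov complete* if it is complete in its two-sided uniformity (the supremum of the left and the right one). For real normed spaces $E,F$ a bilinear map $\omega:E\times F\to\mathbb R$ is *regular* if $|\omega(x,f)|\le\|x\|\,\|f\|$ for all $(x,f)$. It is a *strong duality* if for every norm-unbounded sequence $(x_n)$ in $E$ the set $\{\omega(x_n,f): n\in\mathbb N,\ \|f\|\le1\}$ is unbounded in $\mathbb R$, and for every norm-unbounded sequence $(f_n)$ in $F$ the set $\{\omega(x,f_n): n\in\mathbb N,\ \|x\|\le1\}$ is unbounded in $\mathbb R$. A *(continuous) birepresentation* $\Psi$ of a topological group $G$ in $\omega$ is a pair of continuous actions of $G$ on $E$ and on $F$ by linear isometries such that $\omega(gx,gf)=\omega(x,f)$ for all $g\in G$, $x\in E$, $f\in F$. It is *t-exact* if no strictly coarser, not necessarily Hausdorff, group topology on $G$ keeps both actions continuous (with respect to the norm topologies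 on $E$ and $F$). For a continuous bilinear $\omega$, let $H(\omega)=(\mathbb R\times E)\rtimes F$ be the topological semidirect product for the action $f(a,x)=(a+\omega(x,f),x)$. Let $H_+(\omega)=H(\omega)\rtimes\mathbb R_+$, where the multiplicative group $\mathbb R_+$ of positive reals acts by $t(a,x,f)=(ta,tx,f)$. For a birepresentation $\Psi$ of $G$ in $\omega$, the *induced group* is $M_+(\Psi)=H_+(\omega)\rtimes G$, where $G$ acts by $g(a,x,f,t)=(a,gx,gf,t)$. All these groups carry the product topology. **Theorem.** Let $G$ be a Hausdorff topological group. Then there exist a minimal topological group $M$ and a topological group retraction $p:M\to G$, that is, a continuous homomorphism onto $G$, where $G$ is a topological subgroup of $M$ and $p$ is the identity on $G$. Moreover, $M$ and $p$ can be chosen so that all of the following hold simultaneously. (a) There are real Banach spaces $E,F$, a regular strong duality $\omega:E\times F\to\mathbb R$ and a t-exact birepresentation $\Psi$ of $G$ in $\omega$ such that $\max\{d(E),d(F)\}\le w(G)$ and $$M=M_+(\Psi)=(((\mathbb R\times E)\rtimes F)\rtimes\mathbb R_+)\rtimes G .$$ (b) $p:M\to G$ is the natural projection, with $G$ embedded in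 $M$ as the last factor, and the topological group $\ker p=H_+(\omega)$ is minimal, Weil complete and solvable. (c) $w(M)=w(G)$, $\chi(M)=\chi(G)$ and $\psi(M)=\psi(G)$. (d) If $G$ is Raikov complete, then so is $M$; if $G$ is Weil complete, then so is $M$. (e) If $G$ is solvable, then $M$ is solvable. -/

import Mathlib

open Cardinal Set Topology

universe u

/-! ### Cardinal invariants of topological spaces (all of them infinite by convention) -/

section Invariants

variable (X : Type u) [TopologicalSpace X]

/-- The weight: the least infinite cardinal bounding the size of some base of the topology. -/
noncomputable def weight : Cardinal.{u} :=
  max ℵ₀ (sInf {κ | ∃ B : Set (Set X), TopologicalSpace.IsTopologicalBasis B ∧ #B = κ})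

/-- The density: the least infinite cardinal bounding the size of some dense subset. -/
noncomputable def density : Cardinal.{u} :=
  max ℵ₀ (sInf {κ | ∃ D : Set X, Dense D ∧ #D = κ})

/-- The least size of a base of neighbourhoods at a point. -/
noncomputable def characterAt (x : X) : Cardinal.{u} :=
  sInf {κ | ∃ B : Set (Set X), (𝓝 x).HasBasis (fun U => U ∈ B) id ∧ #B = κ}

/-- The character. -/
noncomputable def character : Cardinal.{u} := max ℵ₀ (⨆ x : X, characterAt X x)

/-- The least size of a family of open sets whose intersection is the given point. -/
noncomputable def pseudocharacterAt (x : X) : Cardinal.{u} :=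
  sInf {κ | ∃ B : Set (Set X), (∀ U ∈ B, IsOpen U) ∧ ⋂₀ B = {x} ∧ #B = κ}

/-- The pseudocharacter. -/
noncomputable def pseudocharacter : Cardinal.{u} := max ℵ₀ (⨆ x : X, pseudocharacterAt X x)

end Invariants

/-! ### Topological groups -/

section Groups

variable (G : Type*) [Group G] [τ : TopologicalSpace G]

/-- A minimal group: a Hausdorff topological group having no strictly coarser Hausdorff group
topology. (In Mathlib's order `τ ≤ τ'` says that `τ'` is coarser than `τ`.) -/
def IsMinimalGroup : Prop :=
  IsTopologicalGroup G ∧ T2Space G ∧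
    ∀ τ' : TopologicalSpace G, @IsTopologicalGroup G τ' _ → @T2Space G τ' → τ ≤ τ' → τ' = τ

/-- Weil completeness: completeness of the right uniformity. -/
def IsWeilComplete [IsTopologicalGroup G] : Prop :=
  @CompleteSpace G (IsTopologicalGroup.rightUniformSpace G)

/-- Raikov completeness: completeness of the two-sided uniformity, the supremum of the left and
the right one (an infimum in Mathlib's order on uniform structures). -/
def IsRaikovComplete [IsTopologicalGroup G] : Prop :=
  @CompleteSpace G
    (IsTopologicalGroup.leftUniformSpace G ⊓ IsTopologicalGroup.rightUniformSpace G)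

variable {G} {M : Type*} [Group M] [TopologicalSpace M]

/-- `p : M → G` is a retraction of topological groups, where `G` is regarded as a subgroup of `M`
through `s`. (As `p` is a continuous left inverse of the continuous map `s`, the latter is a
topological embedding.) -/
structure IsGroupRetraction (p : M →* G) (s : G →* M) : Prop where
  continuous_retraction : Continuous p
  continuous_inclusion : Continuous s
  retraction_inclusion : ∀ g, p (s g) = g

end Groups

/-! ### Topological semidirect products -/

namespace SemidirectProduct

variable {N G : Type*} [Group N] [Group G] [TopologicalSpace N] [TopologicalSpace G]
  {φ : G →* MulAut N}

/-- A semidirect product carries the product topology. -/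
instance instTopologicalSpaceSemidirect : TopologicalSpace (N ⋊[φ] G) :=
  TopologicalSpace.induced equivProd inferInstance

theorem continuous_equivProd : Continuous (equivProd : N ⋊[φ] G ≃ N × G) :=
  continuous_induced_dom

theorem continuous_left : Continuous (fun x : N ⋊[φ] G => x.left) :=
  continuous_fst.comp continuous_equivProd

theorem continuous_right : Continuous (fun x : N ⋊[φ] G => x.right) :=
  continuous_snd.comp continuous_equivProd

theorem continuous_mk {Y : Type*} [TopologicalSpace Y] {f : Y → N} {g : Y → G}
    (hf : Continuous f) (hg : Continuous g) :
    Continuous (fun y => (⟨f y, g y⟩ : N ⋊[φ] G)) :=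
  continuous_induced_rng.2 (hf.prodMk hg)

/-- If the action `G × N → N` is continuous, the semidirect product is a topological group. -/
theorem isTopologicalGroup_of_continuous [IsTopologicalGroup N] [IsTopologicalGroup G]
    (h : Continuous fun p : G × N => φ p.1 p.2) : IsTopologicalGroup (N ⋊[φ] G) where
  continuous_mul := by
    refine continuous_mk ?_ ?_
    · exact (continuous_left.comp continuous_fst).mul
        (h.comp ((continuous_right.comp continuous_fst).prodMk
          (continuous_left.comp continuous_snd)))
    · exact (continuous_right.comp continuous_fst).mul (continuous_right.comp continuous_snd)
  continuous_inv := by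
    refine continuous_mk ?_ ?_
    · exact h.comp (continuous_right.inv.prodMk continuous_left.inv)
    · exact continuous_right.inv

end SemidirectProduct

/-! ### The groups `H(ω)` and `H₊(ω)` -/

/-- The multiplicative group of positive reals. -/
abbrev PosReal : Type := {t : ℝ // 0 < t}

instance : IsTopologicalGroup PosReal where
  continuous_mul := Continuous.subtype_mk
    ((continuous_subtype_val.comp continuous_fst).mul
      (continuous_subtype_val.comp continuous_snd)) _
  continuous_inv := Continuous.subtype_mk
    (continuous_subtype_val.inv₀ fun t => t.2.ne') _

section Heisenberg

variable {E F : Type*} [NormedAddCommGroup E] [NormedSpace ℝ E]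
  [NormedAddCommGroup F] [NormedSpace ℝ F]

open Multiplicative

/-- The action of `F` on `ℝ × E` given by `f (a, x) = (a + ω(x, f), x)`. -/
noncomputable def heisenbergAction (ω : E →L[ℝ] F →L[ℝ] ℝ) :
    Multiplicative F →* MulAut (Multiplicative (ℝ × E)) where
  toFun f :=
    { toFun := fun u => ofAdd (u.toAdd.1 + ω u.toAdd.2 f.toAdd, u.toAdd.2)
      invFun := fun u => ofAdd (u.toAdd.1 - ω u.toAdd.2 f.toAdd, u.toAdd.2)
      left_inv := fun u => by simp
      right_inv := fun u => by simp
      map_mul' := fun u v => by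
        rw [← ofAdd_add]
        congr 1
        ext
        · simp; ring
        · simp }
  map_one' := by ext u <;> simp
  map_mul' f g := by
    ext u
    · simp; ring
    · simp

@[simp] theorem heisenbergAction_apply (ω : E →L[ℝ] F →L[ℝ] ℝ) (f : Multiplicative F)
    (u : Multiplicative (ℝ × E)) :
    heisenbergAction ω f u = ofAdd (u.toAdd.1 + ω u.toAdd.2 f.toAdd, u.toAdd.2) := rfl

/-- The generalized Heisenberg group `H(ω) = (ℝ × E) ⋊ F`, with multiplication
`(a₁, x₁, f₁) (a₂, x₂, f₂) = (a₁ + a₂ + ω(x₂, f₁), x₁ + x₂, f₁ + f₂)`. -/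
abbrev Heisenberg (ω : E →L[ℝ] F →L[ℝ] ℝ) : Type _ :=
  Multiplicative (ℝ × E) ⋊[heisenbergAction ω] Multiplicative F

instance (ω : E →L[ℝ] F →L[ℝ] ℝ) : IsTopologicalGroup (Heisenberg ω) :=
  SemidirectProduct.isTopologicalGroup_of_continuous (by
    have h : Continuous fun p : F × (ℝ × E) => (p.2.1 + ω p.2.2 p.1, p.2.2) := by fun_prop
    exact h)

/-- The action of the positive reals on `H(ω)` given by `t (a, x, f) = (t a, t x, f)`. -/
noncomputable def scalingAction (ω : E →L[ℝ] F →L[ℝ] ℝ) : PosReal →* MulAut (Heisenberg ω) where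
  toFun t :=
    { toFun := fun u => ⟨ofAdd ((t : ℝ) • u.left.toAdd), u.right⟩
      invFun := fun u => ⟨ofAdd ((t : ℝ)⁻¹ • u.left.toAdd), u.right⟩
      left_inv := fun u => by
        ext <;> simp [t.2.ne']
      right_inv := fun u => by
        ext <;> simp [t.2.ne']
      map_mul' := fun u v => by
        ext
        · simp [-SemidirectProduct.mk_eq_inl_mul_inr]; ring
        · simp [-SemidirectProduct.mk_eq_inl_mul_inr]
        · simp [-SemidirectProduct.mk_eq_inl_mul_inr] }
  map_one' := by ext u <;> simp
  map_mul' s t := by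
    ext u
    · simp [mul_assoc]
    · simp [mul_smul]
    · simp

theorem scalingAction_apply (ω : E →L[ℝ] F →L[ℝ] ℝ) (t : PosReal) (u : Heisenberg ω) :
    scalingAction ω t u = ⟨ofAdd ((t : ℝ) • u.left.toAdd), u.right⟩ := rfl

/-- The group `H₊(ω) = ((ℝ × E) ⋊ F) ⋊ ℝ₊`. -/
abbrev HeisenbergPlus (ω : E →L[ℝ] F →L[ℝ] ℝ) : Type _ :=
  Heisenberg ω ⋊[scalingAction ω] PosReal

instance (ω : E →L[ℝ] F →L[ℝ] ℝ) : IsTopologicalGroup (HeisenbergPlus ω) :=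
  SemidirectProduct.isTopologicalGroup_of_continuous (by
    refine SemidirectProduct.continuous_mk ?_
      (SemidirectProduct.continuous_right.comp continuous_snd)
    have h : Continuous fun p : ℝ × (ℝ × E) => p.1 • p.2 := by fun_prop
    have hl : Continuous fun p : PosReal × Heisenberg ω => p.2.left.toAdd :=
      continuous_toAdd.comp (SemidirectProduct.continuous_left.comp continuous_snd)
    exact h.comp ((continuous_subtype_val.comp continuous_fst).prodMk hl))

/-- `|ω(x, f)| ≤ ‖x‖ ‖f‖` everywhere. -/
def IsRegularForm (ω : E →L[ℝ] F →L[ℝ] ℝ) : Prop :=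
  ∀ (x : E) (f : F), |ω x f| ≤ ‖x‖ * ‖f‖

/-- For each norm-unbounded sequence in `E`, its values at the unit ball of `F` are unbounded;
and the same with `E` and `F` exchanged. -/
structure IsStrongDuality (ω : E →L[ℝ] F →L[ℝ] ℝ) : Prop where
  left_strong : ∀ x : ℕ → E, ¬ Bornology.IsBounded (range x) →
    ¬ Bornology.IsBounded {r : ℝ | ∃ (n : ℕ) (f : F), ‖f‖ ≤ 1 ∧ ω (x n) f = r}
  right_strong : ∀ f : ℕ → F, ¬ Bornology.IsBounded (range f) →
    ¬ Bornology.IsBounded {r : ℝ | ∃ (n : ℕ) (x : E), ‖x‖ ≤ 1 ∧ ω x (f n) = r}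

end Heisenberg

/-! ### Birepresentations and induced groups -/

section Birepresentations

/-- The action `G × E → E` given by `h` is continuous for the topology `τ` on `G` and the norm
topology on `E`. -/
def IsContinuousAction {G E : Type*} [Group G] [NormedAddCommGroup E] [NormedSpace ℝ E]
    (τ : TopologicalSpace G) (h : G →* (E ≃ₗᵢ[ℝ] E)) : Prop :=
  Continuous fun p : G × E => h p.1 p.2

/-- No strictly coarser, not necessarily Hausdorff, group topology on `G` keeps both actions
continuous. -/
def IsTExactPair {G E F : Type*} [Group G] [NormedAddCommGroup E] [NormedSpace ℝ E]
    [NormedAddCommGroup F] [NormedSpace ℝ F] (τ : TopologicalSpace G)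
    (h₁ : G →* (E ≃ₗᵢ[ℝ] E)) (h₂ : G →* (F ≃ₗᵢ[ℝ] F)) : Prop :=
  ∀ τ' : TopologicalSpace G, @IsTopologicalGroup G τ' _ → τ ≤ τ' →
    IsContinuousAction τ' h₁ → IsContinuousAction τ' h₂ → τ' = τ

variable (G : Type*) [Group G] [τ : TopologicalSpace G]
  {E F : Type*} [NormedAddCommGroup E] [NormedSpace ℝ E]
  [NormedAddCommGroup F] [NormedSpace ℝ F]

/-- A continuous birepresentation of `G` in `ω`: two continuous actions of `G` by linear
isometries, on `E` and on `F`, that leave `ω` invariant. -/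
structure Birepresentation (ω : E →L[ℝ] F →L[ℝ] ℝ) where
  actE : G →* (E ≃ₗᵢ[ℝ] E)
  actF : G →* (F ≃ₗᵢ[ℝ] F)
  continuous_actE : IsContinuousAction τ actE
  continuous_actF : IsContinuousAction τ actF
  invariant : ∀ (g : G) (x : E) (f : F), ω (actE g x) (actF g f) = ω x f

variable {G} {ω : E →L[ℝ] F →L[ℝ] ℝ}

namespace Birepresentation

/-- The birepresentation is topologically exact. -/
def IsTExact (Ψ : Birepresentation G ω) : Prop :=
  IsTExactPair τ Ψ.actE Ψ.actF

open Multiplicative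

/-- The action of `g ∈ G` on `H(ω)` given by `g (a, x, f) = (a, g x, g f)`. -/
noncomputable def heisenbergAut (Ψ : Birepresentation G ω) : G →* MulAut (Heisenberg ω) where
  toFun g :=
    { toFun := fun u => ⟨ofAdd (u.left.toAdd.1, Ψ.actE g u.left.toAdd.2),
        ofAdd (Ψ.actF g u.right.toAdd)⟩
      invFun := fun u => ⟨ofAdd (u.left.toAdd.1, Ψ.actE g⁻¹ u.left.toAdd.2),
        ofAdd (Ψ.actF g⁻¹ u.right.toAdd)⟩
      left_inv := fun u => by
        ext <;> simp
      right_inv := fun u => by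
        ext <;> simp
      map_mul' := fun u v => by
        ext <;> simp [-SemidirectProduct.mk_eq_inl_mul_inr, Ψ.invariant] }
  map_one' := by ext u <;> simp
  map_mul' g h := by ext u <;> simp

theorem heisenbergAut_apply (Ψ : Birepresentation G ω) (g : G) (u : Heisenberg ω) :
    Ψ.heisenbergAut g u = ⟨ofAdd (u.left.toAdd.1, Ψ.actE g u.left.toAdd.2),
      ofAdd (Ψ.actF g u.right.toAdd)⟩ := rfl

/-- The action of `G` on `H₊(ω)` given by `g (a, x, f, t) = (a, g x, g f, t)`. -/
noncomputable def inducedAction (Ψ : Birepresentation G ω) : G →* MulAut (HeisenbergPlus ω) where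
  toFun g :=
    { toFun := fun u => ⟨Ψ.heisenbergAut g u.left, u.right⟩
      invFun := fun u => ⟨Ψ.heisenbergAut g⁻¹ u.left, u.right⟩
      left_inv := fun u => by
        ext <;> simp
      right_inv := fun u => by
        ext <;> simp
      map_mul' := fun u v => by
        ext <;> simp [-SemidirectProduct.mk_eq_inl_mul_inr, heisenbergAut_apply,
          scalingAction_apply, Ψ.invariant] }
  map_one' := by ext u <;> simp
  map_mul' g h := by ext u <;> simp

/-- The induced group `M₊(Ψ) = (((ℝ × E) ⋊ F) ⋊ ℝ₊) ⋊ G`. -/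
abbrev InducedGroup (Ψ : Birepresentation G ω) : Type _ :=
  HeisenbergPlus ω ⋊[Ψ.inducedAction] G

instance [IsTopologicalGroup G] (Ψ : Birepresentation G ω) :
    IsTopologicalGroup Ψ.InducedGroup :=
  SemidirectProduct.isTopologicalGroup_of_continuous (by
    have hl : Continuous fun p : G × HeisenbergPlus ω => p.2.left.left.toAdd :=
      continuous_toAdd.comp (SemidirectProduct.continuous_left.comp
        (SemidirectProduct.continuous_left.comp continuous_snd))
    have hr : Continuous fun p : G × HeisenbergPlus ω => p.2.left.right.toAdd :=
      continuous_toAdd.comp (SemidirectProduct.continuous_right.comp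
        (SemidirectProduct.continuous_left.comp continuous_snd))
    refine SemidirectProduct.continuous_mk (SemidirectProduct.continuous_mk ?_ ?_)
      (SemidirectProduct.continuous_right.comp continuous_snd)
    · exact (continuous_fst.comp hl).prodMk
        (Ψ.continuous_actE.comp (continuous_fst.prodMk (continuous_snd.comp hl)))
    · exact Ψ.continuous_actF.comp (continuous_fst.prodMk hr))

/-- The natural projection of the induced group onto `G`. -/
noncomputable abbrev projection (Ψ : Birepresentation G ω) : Ψ.InducedGroup →* G :=
  SemidirectProduct.rightHom

/-- The natural inclusion of `G` into the induced group. -/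
noncomputable abbrev inclusion (Ψ : Birepresentation G ω) : G →* Ψ.InducedGroup :=
  SemidirectProduct.inr

end Birepresentation

end Birepresentations

/-!
The group `M = H₊(ω) ⋊ G` is minimal because commutators carry every coarser Hausdorff group
topology back to the given one. In `H₊(ω) = ((ℝ × E) ⋊ F) ⋊ ℝ₊` the commutator of `t ∈ ℝ₊` with
`a ∈ ℝ` is `(t - 1) a`, so a neighbourhood of the identity containing large `a` would yield a fixed
non-trivial element; hence the line `ℝ` keeps its topology. Conjugation on `ℝ` detects the
coordinate `t`, and the commutators with `F` and with `E` are values of `ω` on the other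
coordinates: as `ω` is a strong duality, these are bounded near the identity, and passing to
powers makes them small (`HeisenbergPlus.isInducing_of_continuous`). In `M` the conjugation action
on the minimal subgroup `H₊(ω)` stays continuous for a coarser topology. It contains the actions of
`G` on `E` and `F`, so the quotient topology on `G` keeps them continuous and t-exactness identifies
it with the given one (`Birepresentation.isInducing_of_continuous`).

A t-exact birepresentation comes from continuous group seminorms `N ≤ 1` describing the topology of
`G` (`exists_groupSeminorm_of_mem_nhds`). Let `E` be the closed span of the left translates of `N`
in the space of bounded functions with bounded Hölder quotients of exponent `1 / 2` for the
left-invariant pseudometric `N (x⁻¹ y)`, and `F` the closed span of the point evaluations in the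
dual of `E`. The evaluations and their divided differences are norming, so the evaluation pairing
is a strong duality. The exponent makes both actions continuous: evaluations at `x` and `y` differ
by at most `√(N (x⁻¹ y))`, and the translate of `N` by `g` differs from `N` by at most `min`
of `2 N (x⁻¹ y)` and `2 N g` in each difference, so by at most `2 √(N g)` in norm. The action on `E`
is t-exact because `N g` is a value of a translate of `N`. Several seminorms are treated together
by placing them on disjoint copies of `G`, one for each member of a minimal base that contains the
identity, which keeps the densities below the weight.

Completeness is inherited from `H₊(ω)` and `G` by writing `m = g k` with `k ∈ H₊(ω)`: for a right
Cauchy filter whose projection to `G` converges, the `k` form a right Cauchy filter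
(`SemidirectProduct.exists_le_nhds`). The cardinal invariants agree because `M` is homeomorphic to
the product of `G` and a metric space of density at most the weight of `G`.
-/

/-! ### Continuous group seminorms -/

section Seminorms

open Filter Uniformity

variable {G : Type*} [Group G]

theorem GroupSeminorm.sub_le_inv_mul (N : GroupSeminorm G) (x y : G) : N x - N y ≤ N (x⁻¹ * y) := by
  have h := map_mul_le_add N y (y⁻¹ * x)
  have h' := map_inv_eq_map N (x⁻¹ * y)
  rw [mul_inv_cancel_left] at h
  rw [mul_inv_rev, inv_inv] at h'
  linarith

theorem GroupSeminorm.abs_sub_le_inv_mul (N : GroupSeminorm G) (x y : G) :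
    |N x - N y| ≤ N (x⁻¹ * y) := by
  have h := N.sub_le_inv_mul y x
  have h' := map_inv_eq_map N (x⁻¹ * y)
  rw [mul_inv_rev, inv_inv] at h'
  exact abs_sub_le_iff.2 ⟨N.sub_le_inv_mul x y, by linarith⟩

theorem GroupSeminorm.abs_inv_mul_sub_le (N : GroupSeminorm G) (g x : G) :
    |N (g⁻¹ * x) - N x| ≤ N g := by
  have h := map_mul_le_add N g (g⁻¹ * x)
  have h' := map_mul_le_add N g⁻¹ x
  rw [mul_inv_cancel_left] at h
  rw [map_inv_eq_map N g] at h'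
  exact abs_sub_le_iff.2 ⟨by linarith, by linarith⟩

/-- The smallest left-invariant function above a pseudometric truncated at `1`, as a function
of one variable. -/
noncomputable def GroupSeminorm.ofPseudoMetric (d : PseudoMetricSpace G) : GroupSeminorm G where
  toFun g := ⨆ h : G, min 1 (dist h (h * g))
  map_one' := by simp
  mul_le' g k := by
    have hb : ∀ g : G, BddAbove (range fun h : G => min 1 (dist h (h * g))) := fun g =>
      ⟨1, by rintro _ ⟨h, rfl⟩; exact min_le_left _ _⟩
    refine ciSup_le fun h => ?_
    have h1 := le_ciSup (hb g) h
    have h2 := le_ciSup (hb k) (h * g)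
    have h3 := dist_triangle h (h * g) (h * g * k)
    refine le_trans ?_ (add_le_add h1 h2)
    have h4 : 0 ≤ dist h (h * g) := dist_nonneg
    have h5 : 0 ≤ dist (h * g) (h * g * k) := dist_nonneg
    rw [← mul_assoc]
    rcases le_total 1 (dist h (h * g)) with h6 | h6
    · rw [min_eq_left h6]
      have : 0 ≤ min 1 (dist (h * g) (h * g * k)) := by positivity
      linarith [min_le_left 1 (dist h (h * g * k))]
    · rw [min_eq_right h6]
      rcases le_total 1 (dist (h * g) (h * g * k)) with h7 | h7
      · rw [min_eq_left h7]
        linarith [min_le_left 1 (dist h (h * g * k))]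
      · rw [min_eq_right h7]
        linarith [min_le_right 1 (dist h (h * g * k))]
  inv' g := by
    refine (Equiv.mulRight g⁻¹).iSup_congr fun h => ?_
    simp [dist_comm]

variable [TopologicalSpace G] [IsTopologicalGroup G]

theorem GroupSeminorm.continuous_of_tendsto (N : GroupSeminorm G)
    (h : Tendsto N (𝓝 1) (𝓝 0)) : Continuous N := by
  refine continuous_iff_continuousAt.2 fun g => ?_
  have h1 : Tendsto (fun x => N (x⁻¹ * g)) (𝓝 g) (𝓝 0) := by
    refine h.comp ?_
    have : Continuous fun x : G => x⁻¹ * g := by fun_prop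
    simpa using this.tendsto g
  refine tendsto_iff_dist_tendsto_zero.2 (squeeze_zero (fun _ => dist_nonneg) (fun x => ?_) h1)
  exact N.abs_sub_le_inv_mul x g

/-- Birkhoff–Kakutani: the neighbourhoods of the identity are described by continuous group
seminorms with values in `[0, 1]`. The seminorm is obtained from a pseudometric for the left
uniform structure generated by a sequence of neighbourhoods each of which contains the square
of the next one. -/
theorem exists_groupSeminorm_of_mem_nhds {U : Set G} (hU : U ∈ 𝓝 (1 : G)) :
    ∃ N : GroupSeminorm G, Continuous N ∧ (∀ g, N g ≤ 1) ∧ ∃ ε > 0, ∀ g, N g < ε → g ∈ U := by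
  have key : ∀ S : {S : Set G // S ∈ 𝓝 (1 : G)}, ∃ T : {S : Set G // S ∈ 𝓝 (1 : G)},
      (∀ g ∈ T.1, g⁻¹ ∈ S.1) ∧ ∀ g ∈ T.1, ∀ h ∈ T.1, g * h ∈ S.1 := by
    rintro ⟨S, hS⟩
    obtain ⟨V, hV, hV'⟩ := exists_nhds_one_split hS
    exact ⟨⟨V ∩ S⁻¹, inter_mem hV (inv_mem_nhds_one G hS)⟩, fun g hg => hg.2,
      fun g hg h hh => hV' g hg.1 h hh.1⟩
  choose T hTinv hTmul using key
  let V : ℕ → {S : Set G // S ∈ 𝓝 (1 : G)} := fun n => T^[n] ⟨U, hU⟩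
  have hVs : ∀ n, V (n + 1) = T (V n) := fun n => Function.iterate_succ_apply' T n _
  have hV1 : ∀ n, (1 : G) ∈ (V n).1 := fun n => mem_of_mem_nhds (V n).2
  have hVinv : ∀ n, ∀ g ∈ (V (n + 1)).1, g⁻¹ ∈ (V n).1 := fun n g hg => by
    rw [hVs] at hg; exact hTinv _ g hg
  have hVmul : ∀ n, ∀ g ∈ (V (n + 1)).1, ∀ h ∈ (V (n + 1)).1, g * h ∈ (V n).1 :=
    fun n g hg h hh => by
      rw [hVs] at hg hh; exact hTmul _ g hg h hh
  have hVanti : Antitone fun n => {p : G × G | p.1⁻¹ * p.2 ∈ (V n).1} :=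
    antitone_nat_of_succ_le fun n p hp => by
      simpa using hVmul n _ hp _ (hV1 (n + 1))
  have hB := hasBasis_iInf_principal hVanti.directed_ge
  let c : UniformSpace.Core G :=
    { uniformity := ⨅ n, 𝓟 {p : G × G | p.1⁻¹ * p.2 ∈ (V n).1}
      refl := by
        refine le_iInf fun n => principal_mono.2 ?_
        rintro ⟨x, y⟩ h
        obtain rfl : x = y := h
        simpa using hV1 n
      symm := by
        refine hB.tendsto_iff hB |>.2 fun n _ => ⟨n + 1, trivial, fun p hp => ?_⟩
        simpa using hVinv n _ hp
      comp := by
        refine ((hB.lift' (monotone_id.relComp monotone_id)).le_basis_iff hB).2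
          fun n _ => ⟨n + 1, trivial, ?_⟩
        rintro ⟨x, y⟩ ⟨z, hxz, hzy⟩
        have := hVmul n _ hxz _ hzy
        simpa [mul_assoc] using this }
  let u : UniformSpace G := UniformSpace.ofCore c
  have hu : (𝓤 G).HasBasis (fun _ => True) fun n => {p : G × G | p.1⁻¹ * p.2 ∈ (V n).1} := hB
  have : IsCountablyGenerated (𝓤 G) := hu.isCountablyGenerated
  obtain ⟨d, hd⟩ := UniformSpace.metrizable_uniformity G
  have hdb : (𝓤 G).HasBasis (fun ε : ℝ => 0 < ε) fun ε => {p : G × G | dist p.1 p.2 < ε} := by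
    rw [← hd]; exact Metric.uniformity_basis_dist
  have hsub : ∀ g h : G, min 1 (dist h (h * g)) ≤ GroupSeminorm.ofPseudoMetric d g := fun g h =>
    le_ciSup (f := fun h : G => min 1 (dist h (h * g)))
      ⟨1, by rintro _ ⟨h, rfl⟩; exact min_le_left _ _⟩ h
  refine ⟨GroupSeminorm.ofPseudoMetric d, ?_, fun g => ciSup_le fun h => min_le_left _ _, ?_⟩
  · refine GroupSeminorm.continuous_of_tendsto _ ?_
    refine Metric.tendsto_nhds.2 fun ε hε => ?_
    obtain ⟨n, -, hn⟩ := hu.mem_iff.1 (hdb.mem_of_mem (half_pos hε))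
    filter_upwards [(V n).2] with g hg
    rw [Real.dist_eq, sub_zero, abs_of_nonneg (apply_nonneg _ _)]
    refine lt_of_le_of_lt (ciSup_le fun h => (min_le_right _ _).trans (le_of_lt ?_))
      (half_lt_self hε)
    exact hn (a := (h, h * g)) (by simpa using hg)
  · obtain ⟨ε, hε, h⟩ := hdb.mem_iff.1 (hu.mem_of_mem (i := 0) trivial)
    refine ⟨min 1 ε, by positivity, fun g hg => ?_⟩
    have h1 := hsub g 1
    rw [one_mul] at h1
    have h2 : dist 1 g < ε := by
      by_contra hlt
      exact absurd (h1.trans_lt hg) (not_lt.2 (min_le_min_left 1 (not_lt.1 hlt)))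
    have h3 : g ∈ (V 0).1 := by simpa using h (a := (1, g)) h2
    exact h3

end Seminorms

/-! ### Strong dualities and minimality of `H₊(ω)` -/

section Minimality

open Filter Multiplicative

variable {E F : Type*} [NormedAddCommGroup E] [NormedSpace ℝ E]
  [NormedAddCommGroup F] [NormedSpace ℝ F] {ω : E →L[ℝ] F →L[ℝ] ℝ}

/-- In a strong duality the polar of the unit ball of `F` is bounded. -/
theorem IsStrongDuality.exists_bound_left (hω : IsStrongDuality ω) :
    ∃ C, ∀ x : E, (∀ f : F, ‖f‖ ≤ 1 → |ω x f| ≤ 1) → ‖x‖ ≤ C := by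
  by_contra! h
  choose x hx hx' using fun n : ℕ => h n
  refine hω.left_strong x (fun hb => ?_) ?_
  · obtain ⟨C, hC⟩ := hb.exists_norm_le
    obtain ⟨n, hn⟩ := exists_nat_gt C
    exact absurd (hC _ ⟨n, rfl⟩) (not_le.2 (hn.trans (hx' n)))
  · refine isBounded_iff_forall_norm_le.2 ⟨1, ?_⟩
    rintro _ ⟨n, f, hf, rfl⟩
    exact hx n f hf

/-- In a strong duality the polar of the unit ball of `E` is bounded. -/
theorem IsStrongDuality.exists_bound_right (hω : IsStrongDuality ω) :
    ∃ C, ∀ f : F, (∀ x : E, ‖x‖ ≤ 1 → |ω x f| ≤ 1) → ‖f‖ ≤ C := by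
  by_contra! h
  choose f hf hf' using fun n : ℕ => h n
  refine hω.right_strong f (fun hb => ?_) ?_
  · obtain ⟨C, hC⟩ := hb.exists_norm_le
    obtain ⟨n, hn⟩ := exists_nat_gt C
    exact absurd (hC _ ⟨n, rfl⟩) (not_le.2 (hn.trans (hf' n)))
  · refine isBounded_iff_forall_norm_le.2 ⟨1, ?_⟩
    rintro _ ⟨n, x, hx, rfl⟩
    exact hf n x hx

namespace HeisenbergPlus

variable (ω) in
/-- The element `(a, 0, 0, 1)`. -/
noncomputable def ofReal (a : ℝ) : HeisenbergPlus ω := ⟨⟨ofAdd (a, 0), 1⟩, 1⟩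

variable (ω) in
/-- The element `(0, x, 0, 1)`. -/
noncomputable def ofE (x : E) : HeisenbergPlus ω := ⟨⟨ofAdd (0, x), 1⟩, 1⟩

variable (ω) in
/-- The element `(0, 0, f, 1)`. -/
noncomputable def ofF (f : F) : HeisenbergPlus ω := ⟨⟨1, ofAdd f⟩, 1⟩

variable (ω) in
/-- The element `(0, 0, 0, t)`. -/
noncomputable def ofPos (t : PosReal) : HeisenbergPlus ω := ⟨1, t⟩

/-- The coordinate `a` of `(a, x, f, t)`. -/
noncomputable def re (m : HeisenbergPlus ω) : ℝ := m.left.left.toAdd.1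

/-- The coordinate `x` of `(a, x, f, t)`. -/
noncomputable def coE (m : HeisenbergPlus ω) : E := m.left.left.toAdd.2

/-- The coordinate `f` of `(a, x, f, t)`. -/
noncomputable def coF (m : HeisenbergPlus ω) : F := m.left.right.toAdd

/-- The coordinate `t` of `(a, x, f, t)`, as a real number. -/
noncomputable def pos (m : HeisenbergPlus ω) : ℝ := m.right

theorem pos_pos (m : HeisenbergPlus ω) : 0 < m.pos := m.right.2

theorem ext_coords {m m' : HeisenbergPlus ω} (h1 : m.re = m'.re) (h2 : m.coE = m'.coE)
    (h3 : m.coF = m'.coF) (h4 : m.pos = m'.pos) : m = m' := by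
  refine SemidirectProduct.ext (SemidirectProduct.ext (Prod.ext h1 h2) h3) (Subtype.ext h4)

section Coordinates

variable (m m' : HeisenbergPlus ω)

@[simp] theorem re_one : (1 : HeisenbergPlus ω).re = 0 := rfl
@[simp] theorem coE_one : (1 : HeisenbergPlus ω).coE = 0 := rfl
@[simp] theorem coF_one : (1 : HeisenbergPlus ω).coF = 0 := rfl
@[simp] theorem pos_one : (1 : HeisenbergPlus ω).pos = 1 := rfl
@[simp] theorem re_mul : (m * m').re = m.re + m.pos * (m'.re) + m.pos * ω m'.coE m.coF := by
  have : (m * m').re = m.re + (m.pos * m'.re + ω (m.pos • m'.coE) m.coF) := rfl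
  rw [this, map_smul]; simp [add_assoc]
@[simp] theorem coE_mul : (m * m').coE = m.coE + m.pos • m'.coE := rfl
@[simp] theorem coF_mul : (m * m').coF = m.coF + m'.coF := rfl
@[simp] theorem pos_mul : (m * m').pos = m.pos * m'.pos := rfl
@[simp] theorem pos_inv : (m⁻¹).pos = m.pos⁻¹ := rfl
@[simp] theorem coF_inv : (m⁻¹).coF = -m.coF := rfl
@[simp] theorem coE_inv : (m⁻¹).coE = -(m.pos⁻¹ • m.coE) := by
  have h := coE_mul m m⁻¹
  rw [mul_inv_cancel, coE_one] at h
  have h' := congrArg (fun z => m.pos⁻¹ • z) h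
  simp only [smul_add, smul_smul, inv_mul_cancel₀ m.pos_pos.ne', one_smul, smul_zero] at h'
  exact (neg_eq_of_add_eq_zero_right h'.symm).symm
@[simp] theorem re_inv : (m⁻¹).re = -(m.pos⁻¹ * m.re) + m.pos⁻¹ * ω m.coE m.coF := by
  have h := re_mul m m⁻¹
  rw [mul_inv_cancel, re_one, coE_inv, map_neg, map_smul] at h
  simp only [neg_apply, smul_apply, smul_eq_mul, mul_neg] at h
  have := m.pos_pos.ne'
  field_simp at h ⊢
  linarith

@[simp] theorem re_ofReal (a : ℝ) : (ofReal ω a).re = a := rfl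
@[simp] theorem coE_ofReal (a : ℝ) : (ofReal ω a).coE = 0 := rfl
@[simp] theorem coF_ofReal (a : ℝ) : (ofReal ω a).coF = 0 := rfl
@[simp] theorem pos_ofReal (a : ℝ) : (ofReal ω a).pos = 1 := rfl
@[simp] theorem re_ofE (x : E) : (ofE ω x).re = 0 := rfl
@[simp] theorem coE_ofE (x : E) : (ofE ω x).coE = x := rfl
@[simp] theorem coF_ofE (x : E) : (ofE ω x).coF = 0 := rfl
@[simp] theorem pos_ofE (x : E) : (ofE ω x).pos = 1 := rfl
@[simp] theorem re_ofF (f : F) : (ofF ω f).re = 0 := rfl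
@[simp] theorem coE_ofF (f : F) : (ofF ω f).coE = 0 := rfl
@[simp] theorem coF_ofF (f : F) : (ofF ω f).coF = f := rfl
@[simp] theorem pos_ofF (f : F) : (ofF ω f).pos = 1 := rfl
@[simp] theorem re_ofPos (t : PosReal) : (ofPos ω t).re = 0 := rfl
@[simp] theorem coE_ofPos (t : PosReal) : (ofPos ω t).coE = 0 := rfl
@[simp] theorem coF_ofPos (t : PosReal) : (ofPos ω t).coF = 0 := rfl
@[simp] theorem pos_ofPos (t : PosReal) : (ofPos ω t).pos = t := rfl

end Coordinates

theorem continuous_re : Continuous (re : HeisenbergPlus ω → ℝ) :=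
  continuous_fst.comp (continuous_toAdd.comp
    (SemidirectProduct.continuous_left.comp SemidirectProduct.continuous_left))

theorem continuous_coE : Continuous (coE : HeisenbergPlus ω → E) :=
  continuous_snd.comp (continuous_toAdd.comp
    (SemidirectProduct.continuous_left.comp SemidirectProduct.continuous_left))

theorem continuous_coF : Continuous (coF : HeisenbergPlus ω → F) :=
  continuous_toAdd.comp
    (SemidirectProduct.continuous_right.comp SemidirectProduct.continuous_left)

theorem continuous_ofE : Continuous (ofE ω) :=
  SemidirectProduct.continuous_mk (SemidirectProduct.continuous_mk
    (continuous_const.prodMk continuous_id) continuous_const) continuous_const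

theorem continuous_ofF : Continuous (ofF ω) :=
  SemidirectProduct.continuous_mk (SemidirectProduct.continuous_mk
    continuous_const continuous_id) continuous_const

theorem continuous_ofPos : Continuous (ofPos ω) :=
  SemidirectProduct.continuous_mk continuous_const continuous_id

/-- The topology of `H₊(ω)` is the product topology in the four coordinates. -/
theorem tendsto_nhds_one {α : Type*} {l : Filter α} {u : α → HeisenbergPlus ω}
    (h1 : Tendsto (fun i => (u i).re) l (𝓝 0)) (h2 : Tendsto (fun i => (u i).coE) l (𝓝 0))
    (h3 : Tendsto (fun i => (u i).coF) l (𝓝 0)) (h4 : Tendsto (fun i => (u i).pos) l (𝓝 1)) :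
    Tendsto u l (𝓝 1) := by
  have ht : Tendsto (fun i => (u i).right) l (𝓝 1) := tendsto_subtype_rng.2 h4
  have hc : Continuous fun p : (ℝ × E) × F × PosReal =>
      (⟨⟨ofAdd p.1, ofAdd p.2.1⟩, p.2.2⟩ : HeisenbergPlus ω) :=
    SemidirectProduct.continuous_mk (SemidirectProduct.continuous_mk
      continuous_fst continuous_snd.fst) continuous_snd.snd
  exact (hc.tendsto ((0, 0), 0, 1)).comp ((h1.prodMk_nhds h2).prodMk_nhds (h3.prodMk_nhds ht))

theorem ofPos_commutator_ofReal (t : PosReal) (a : ℝ) :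
    ofPos ω t * ofReal ω a * (ofPos ω t)⁻¹ * (ofReal ω a)⁻¹ = ofReal ω ((t - 1) * a) := by
  have := t.2.ne'
  apply ext_coords <;> simp [this]; ring

theorem commutator_ofReal (m : HeisenbergPlus ω) (a : ℝ) :
    m * ofReal ω a * m⁻¹ * (ofReal ω a)⁻¹ = ofReal ω ((m.pos - 1) * a) := by
  have := m.pos_pos.ne'
  apply ext_coords <;> simp [this, mul_add]; ring

theorem commutator_ofF (m : HeisenbergPlus ω) (f : F) :
    m * ofF ω f * m⁻¹ * (ofF ω f)⁻¹ = ofReal ω (-ω m.coE f) := by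
  have := m.pos_pos.ne'
  apply ext_coords <;> simp [this, mul_add]

theorem commutator_ofE (m : HeisenbergPlus ω) (y : E) :
    m * ofE ω y * m⁻¹ * (ofE ω y)⁻¹ * (ofE ω ((m.pos - 1) • y))⁻¹ =
      ofReal ω (m.pos * ω y m.coF) := by
  have := m.pos_pos.ne'
  apply ext_coords <;> simp [this, sub_smul, mul_add]
  all_goals abel

theorem coF_pow (m : HeisenbergPlus ω) (n : ℕ) : (m ^ n).coF = n • m.coF := by
  induction n with
  | zero => simp
  | succ n ih => rw [pow_succ, coF_mul, ih, succ_nsmul]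

theorem pos_pow (m : HeisenbergPlus ω) (n : ℕ) : (m ^ n).pos = m.pos ^ n := by
  induction n with
  | zero => simp
  | succ n ih => rw [pow_succ, pos_mul, ih, pow_succ]

theorem coE_pow (m : HeisenbergPlus ω) (n : ℕ) :
    (m ^ n).coE = (∑ i ∈ Finset.range n, m.pos ^ i) • m.coE := by
  induction n with
  | zero => simp
  | succ n ih => rw [pow_succ, coE_mul, ih, pos_pow, Finset.sum_range_succ, add_smul]

theorem ofReal_pow (a : ℝ) (n : ℕ) : ofReal ω a ^ n = ofReal ω (n * a) := by
  induction n with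
  | zero => apply ext_coords <;> simp
  | succ n ih => rw [pow_succ, ih]; apply ext_coords <;> simp; ring

theorem eq_mul (m : HeisenbergPlus ω) :
    m * (ofPos ω m.right)⁻¹ * (ofF ω m.coF)⁻¹ * (ofE ω m.coE)⁻¹ = ofReal ω m.re := by
  have h : (m.right : ℝ) = m.pos := rfl
  have := m.pos_pos.ne'
  apply ext_coords <;> simp [h, this]

end HeisenbergPlus

end Minimality

/-! ### Coarser group topologies on `H₊(ω)` -/

section Minimality

open Filter Multiplicative

variable {E F : Type*} [NormedAddCommGroup E] [NormedSpace ℝ E]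
  [NormedAddCommGroup F] [NormedSpace ℝ F] {ω : E →L[ℝ] F →L[ℝ] ℝ}

namespace HeisenbergPlus

variable {K : Type*} [Group K] [TopologicalSpace K] [IsTopologicalGroup K]
  {e : HeisenbergPlus ω →* K}

section Coarser

variable {α β : Type*} {l : Filter α} {l' : Filter β}

theorem tendsto_comap_mul {u v : α → HeisenbergPlus ω}
    (hu : Tendsto u l (comap e (𝓝 1))) (hv : Tendsto v l (comap e (𝓝 1))) :
    Tendsto (fun i => u i * v i) l (comap e (𝓝 1)) := by
  rw [tendsto_comap_iff] at *
  simpa [Function.comp_def] using hu.mul hv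

theorem tendsto_comap_inv {u : α → HeisenbergPlus ω} (hu : Tendsto u l (comap e (𝓝 1))) :
    Tendsto (fun i => (u i)⁻¹) l (comap e (𝓝 1)) := by
  rw [tendsto_comap_iff] at *
  simpa [Function.comp_def] using hu.inv

theorem tendsto_comap_pow (n : ℕ) :
    Tendsto (fun m : HeisenbergPlus ω => m ^ n) (comap e (𝓝 1)) (comap e (𝓝 1)) := by
  rw [tendsto_comap_iff]
  have h : Tendsto e (comap e (𝓝 1)) (𝓝 1) := tendsto_comap
  simpa [Function.comp_def] using h.pow n

theorem tendsto_comap_conj (h : HeisenbergPlus ω) :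
    Tendsto (fun m : HeisenbergPlus ω => m * h * m⁻¹ * h⁻¹) (comap e (𝓝 1)) (comap e (𝓝 1)) := by
  rw [tendsto_comap_iff]
  have h0 : Tendsto e (comap e (𝓝 1)) (𝓝 1) := tendsto_comap
  simpa [Function.comp_def] using ((h0.mul_const (e h)).mul h0.inv).mul_const (e h)⁻¹

omit [IsTopologicalGroup K] in
theorem tendsto_comap_of_nhds (he : Continuous e) {u : α → HeisenbergPlus ω}
    (hu : Tendsto u l (𝓝 1)) : Tendsto u l (comap e (𝓝 1)) := by
  rw [tendsto_comap_iff]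
  have := (he.tendsto 1).comp hu
  rwa [map_one] at this

theorem tendsto_comap_commutator (he : Continuous e) {u : β → HeisenbergPlus ω}
    (hu : Tendsto u l' (𝓝 1)) :
    Tendsto (fun p : HeisenbergPlus ω × β => p.1 * u p.2 * p.1⁻¹ * (u p.2)⁻¹)
      (comap e (𝓝 1) ×ˢ l') (comap e (𝓝 1)) := by
  have h1 : Tendsto (fun p : HeisenbergPlus ω × β => p.1) (comap e (𝓝 1) ×ˢ l')
    (comap e (𝓝 1)) := tendsto_fst
  have h2 := (tendsto_comap_of_nhds he hu).comp (tendsto_snd (f := comap e (𝓝 1)) (g := l'))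
  exact tendsto_comap_mul (tendsto_comap_mul (tendsto_comap_mul h1 h2) (tendsto_comap_inv h1))
    (tendsto_comap_inv h2)

end Coarser

/-- Near the identity of a coarser Hausdorff group topology the line `ℝ` is bounded: the
commutators of `(a, 0, 0, 1)` with `(0, 0, 0, 1 + 1 / a)` are a fixed non-trivial element. -/
theorem exists_bound_ofReal [T2Space K] (he : Continuous e) (hinj : Function.Injective e) :
    ∃ U ∈ comap e (𝓝 1), ∃ C : ℝ, ∀ a, ofReal ω a ∈ U → |a| ≤ C := by
  have hne : e (ofReal ω 1) ≠ 1 := fun h => by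
    have h' := congrArg re (hinj (h.trans (map_one e).symm))
    simp at h'
  have hU : {m | m ≠ ofReal ω 1} ∈ comap e (𝓝 1) :=
    ⟨{e (ofReal ω 1)}ᶜ, isOpen_compl_singleton.mem_nhds hne.symm, fun m hm h => hm (by simp [h])⟩
  have h1 : Tendsto (ofPos ω) (𝓝 1) (𝓝 1) := continuous_ofPos.tendsto' _ _ rfl
  have h2 := (tendsto_comap_inv (tendsto_comap_commutator he h1)).eventually hU
  obtain ⟨P, hP, Q, hQ, hPQ⟩ := eventually_prod_iff.1 h2
  obtain ⟨δ, hδ, hδQ⟩ := Metric.eventually_nhds_iff.1 hQ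
  refine ⟨{m | P m}, hP, max 1 δ⁻¹, fun a ha => ?_⟩
  by_contra! hlt
  obtain ⟨h3, h4⟩ := max_lt_iff.1 hlt
  have ha0 : a ≠ 0 := fun h => by simp [h] at h3; linarith
  have h5 : |a⁻¹| < 1 := by rw [abs_inv]; exact inv_lt_one_of_one_lt₀ h3
  have h6 : |a⁻¹| < δ := by rw [abs_inv]; exact inv_lt_of_inv_lt₀ hδ h4
  let t : PosReal := ⟨1 + a⁻¹, by linarith [neg_lt_of_abs_lt h5]⟩
  have ht : dist t 1 < δ := by
    have : dist t 1 = |1 + a⁻¹ - 1| := rfl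
    rwa [this, add_sub_cancel_left]
  refine hPQ ha (hδQ ht) ?_
  have h7 := ofPos_commutator_ofReal (ω := ω) t a
  have h8 : ((t : ℝ) - 1) * a = 1 := by simp [t, ha0]
  rw [h8] at h7
  simpa [mul_assoc] using h7

theorem tendsto_of_tendsto_ofReal [T2Space K] (he : Continuous e) (hinj : Function.Injective e)
    {α : Type*} {l : Filter α} {a : α → ℝ}
    (h : Tendsto (fun i => ofReal ω (a i)) l (comap e (𝓝 1))) : Tendsto a l (𝓝 0) := by
  obtain ⟨U, hU, C, hC⟩ := exists_bound_ofReal he hinj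
  refine Metric.tendsto_nhds.2 fun ε hε => ?_
  obtain ⟨n, hn⟩ := exists_nat_gt (C / ε)
  filter_upwards [((tendsto_comap_pow (n + 1)).comp h).eventually hU] with i hi
  have hi' : ofReal ω (a i) ^ (n + 1) ∈ U := hi
  have h1 := hC ((n + 1) * a i) (by simpa [ofReal_pow] using hi')
  rw [Real.dist_eq, sub_zero]
  rw [div_lt_iff₀ hε] at hn
  rw [abs_mul, abs_of_pos (by positivity : (0 : ℝ) < n + 1)] at h1
  by_contra! hlt
  have : (n + 1) * ε ≤ (n + 1) * |a i| := by gcongr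
  linarith

variable [T2Space K]

theorem tendsto_comap_pos (he : Continuous e) (hinj : Function.Injective e) :
    Tendsto pos (comap e (𝓝 1)) (𝓝 1) := by
  have h := tendsto_comap_conj (e := e) (ofReal ω 1)
  simp only [commutator_ofReal, mul_one] at h
  have h' := (tendsto_of_tendsto_ofReal he hinj h).add_const 1
  simpa using h'

/-- A family of linear functionals that tends to zero jointly with the argument is eventually
bounded by `1` on some fixed ball. -/
theorem exists_ball_of_tendsto {α V : Type*} [NormedAddCommGroup V] {l : Filter α}
    {b : α × V → ℝ} (h : Tendsto b (l ×ˢ 𝓝 0) (𝓝 0)) :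
    ∃ δ > 0, ∀ᶠ i in l, ∀ v, ‖v‖ ≤ δ → |b (i, v)| < 1 := by
  have h1 := h.eventually (Metric.ball_mem_nhds (0 : ℝ) one_pos)
  obtain ⟨P, hP, Q, hQ, hPQ⟩ := eventually_prod_iff.1 h1
  obtain ⟨δ, hδ, hδQ⟩ := Metric.eventually_nhds_iff.1 hQ
  refine ⟨δ / 2, half_pos hδ, hP.mono fun i hi v hv => ?_⟩
  have h2 := hPQ hi (hδQ (y := v) (by rw [dist_zero_right]; linarith))
  simpa using h2

theorem eventually_norm_coE_le (hω : IsStrongDuality ω) (he : Continuous e)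
    (hinj : Function.Injective e) : ∃ C : ℝ, ∀ᶠ m in comap e (𝓝 1), ‖m.coE‖ ≤ C := by
  have h1 : Tendsto (ofF ω) (𝓝 0) (𝓝 1) := continuous_ofF.tendsto' _ _ rfl
  have h2 := tendsto_comap_commutator he h1
  simp only [commutator_ofF] at h2
  obtain ⟨δ, hδ, h⟩ := exists_ball_of_tendsto (tendsto_of_tendsto_ofReal he hinj h2)
  obtain ⟨C, hC⟩ := hω.exists_bound_left
  refine ⟨δ⁻¹ * C, h.mono fun m hm => ?_⟩
  have h3 := hC (δ • m.coE) fun f hf => by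
    have h4 := hm (δ • f) (by
      rw [norm_smul, Real.norm_of_nonneg hδ.le]
      exact mul_le_of_le_one_right hδ.le hf)
    rw [map_smul, smul_apply]
    rw [map_smul, abs_neg] at h4
    exact h4.le
  rw [norm_smul, Real.norm_of_nonneg hδ.le] at h3
  rwa [inv_mul_eq_div, le_div_iff₀' hδ]

theorem tendsto_comap_coE (hω : IsStrongDuality ω) (he : Continuous e)
    (hinj : Function.Injective e) : Tendsto coE (comap e (𝓝 1)) (𝓝 0) := by
  obtain ⟨C, hC⟩ := eventually_norm_coE_le hω he hinj
  refine Metric.tendsto_nhds.2 fun ε hε => ?_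
  obtain ⟨n, hn⟩ := exists_nat_gt (2 * C / ε)
  have hsum : Tendsto (fun m : HeisenbergPlus ω => ∑ i ∈ Finset.range (n + 1), m.pos ^ i)
      (comap e (𝓝 1)) (𝓝 (n + 1)) := by
    have hc : Continuous fun t : ℝ => ∑ i ∈ Finset.range (n + 1), t ^ i := by fun_prop
    exact (hc.tendsto' 1 _ (by simp)).comp (tendsto_comap_pos he hinj)
  have hn0 : (0 : ℝ) < n + 1 := by positivity
  filter_upwards [(tendsto_comap_pow (n + 1)).eventually hC,
    hsum.eventually (lt_mem_nhds (half_lt_self hn0))] with m h1 h2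
  rw [coE_pow, norm_smul, Real.norm_of_nonneg (by linarith)] at h1
  rw [dist_zero_right]
  rw [div_lt_iff₀ hε] at hn
  by_contra! hlt
  have := mul_le_mul h2.le hlt hε.le (by linarith)
  linarith

theorem eventually_norm_coF_le (hω : IsStrongDuality ω) (he : Continuous e)
    (hinj : Function.Injective e) : ∃ C : ℝ, ∀ᶠ m in comap e (𝓝 1), ‖m.coF‖ ≤ C := by
  have h1 : Tendsto (ofE ω) (𝓝 0) (𝓝 1) := continuous_ofE.tendsto' _ _ rfl
  have h2 : Tendsto (fun p : HeisenbergPlus ω × E => (p.1.pos - 1) • p.2)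
      (comap e (𝓝 1) ×ˢ 𝓝 0) (𝓝 0) := by
    have h3 := ((tendsto_comap_pos he hinj).comp
      (tendsto_fst (g := 𝓝 (0 : E)))).sub_const 1
    simpa using h3.smul (tendsto_snd (f := comap e (𝓝 1)) (g := 𝓝 (0 : E)))
  have h3 := tendsto_comap_mul (tendsto_comap_commutator he h1)
    (tendsto_comap_inv (tendsto_comap_of_nhds he (h1.comp h2)))
  simp only [Function.comp_def, commutator_ofE] at h3
  obtain ⟨δ, hδ, h⟩ := exists_ball_of_tendsto (tendsto_of_tendsto_ofReal he hinj h3)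
  obtain ⟨C, hC⟩ := hω.exists_bound_right
  refine ⟨(δ / 2)⁻¹ * C, ?_⟩
  filter_upwards [h, (tendsto_comap_pos he hinj).eventually
    (lt_mem_nhds (by norm_num : (1 / 2 : ℝ) < 1))] with m hm ht
  have h4 := hC ((δ / 2) • m.coF) fun y hy => by
    have h5 := hm (δ • y) (by
      rw [norm_smul, Real.norm_of_nonneg hδ.le]
      exact mul_le_of_le_one_right hδ.le hy)
    rw [map_smul, smul_apply, smul_eq_mul, abs_mul, abs_mul, abs_of_pos m.pos_pos,
      abs_of_pos hδ] at h5
    rw [map_smul, smul_eq_mul, abs_mul, abs_of_pos (half_pos hδ)]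
    have : 1 / 2 * (δ * |ω y m.coF|) ≤ m.pos * (δ * |ω y m.coF|) := by gcongr
    linarith
  rw [norm_smul, Real.norm_of_nonneg (half_pos hδ).le] at h4
  rwa [inv_mul_eq_div, le_div_iff₀' (half_pos hδ)]

theorem tendsto_comap_coF (hω : IsStrongDuality ω) (he : Continuous e)
    (hinj : Function.Injective e) : Tendsto coF (comap e (𝓝 1)) (𝓝 0) := by
  obtain ⟨C, hC⟩ := eventually_norm_coF_le hω he hinj
  refine Metric.tendsto_nhds.2 fun ε hε => ?_
  obtain ⟨n, hn⟩ := exists_nat_gt (C / ε)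
  filter_upwards [(tendsto_comap_pow (n + 1)).eventually hC] with m h1
  rw [coF_pow, ← Nat.cast_smul_eq_nsmul ℝ, norm_smul, Real.norm_of_nonneg (by positivity)] at h1
  rw [dist_zero_right]
  rw [div_lt_iff₀ hε] at hn
  by_contra! hlt
  have : ((n + 1 : ℕ) : ℝ) * ε ≤ ((n + 1 : ℕ) : ℝ) * ‖m.coF‖ := by gcongr
  push_cast at this h1
  linarith

/-- Every continuous injective homomorphism from `H₊(ω)`, with `ω` a strong duality, into a
Hausdorff topological group is a topological embedding. -/
theorem isInducing_of_continuous (hω : IsStrongDuality ω) (he : Continuous e)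
    (hinj : Function.Injective e) : IsInducing e := by
  refine IsTopologicalGroup.isInducing_iff_nhds_one.2 (le_antisymm ?_ ?_)
  · simpa using (he.tendsto 1).le_comap
  · have hE := tendsto_comap_coE hω he hinj
    have hF := tendsto_comap_coF hω he hinj
    have ht := tendsto_comap_pos he hinj
    have ht' : Tendsto (fun m : HeisenbergPlus ω => m.right) (comap e (𝓝 1)) (𝓝 1) :=
      tendsto_subtype_rng.2 ht
    have h1 := tendsto_comap_of_nhds he ((continuous_ofE (ω := ω)).tendsto' 0 1 rfl |>.comp hE)
    have h2 := tendsto_comap_of_nhds he ((continuous_ofF (ω := ω)).tendsto' 0 1 rfl |>.comp hF)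
    have h3 := tendsto_comap_of_nhds he ((continuous_ofPos (ω := ω)).tendsto' 1 1 rfl |>.comp ht')
    have h4 := tendsto_comap_mul (tendsto_comap_mul (tendsto_comap_mul tendsto_id
      (tendsto_comap_inv h3)) (tendsto_comap_inv h2)) (tendsto_comap_inv h1)
    simp only [Function.comp_def, id, eq_mul] at h4
    exact tendsto_nhds_one (tendsto_of_tendsto_ofReal he hinj h4) hE hF ht

end HeisenbergPlus

end Minimality

/-! ### Minimality of the induced group -/

section InducedGroup

open Filter Multiplicative

instance SemidirectProduct.instT2Space {N G : Type*} [Group N] [Group G] [TopologicalSpace N]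
    [TopologicalSpace G] [T2Space N] [T2Space G] {φ : G →* MulAut N} : T2Space (N ⋊[φ] G) :=
  .of_injective_continuous equivProd.injective continuous_equivProd

theorem SemidirectProduct.continuous_inl {N G : Type*} [Group N] [Group G] [TopologicalSpace N]
    [TopologicalSpace G] {φ : G →* MulAut N} : Continuous (inl : N →* N ⋊[φ] G) :=
  continuous_mk continuous_id continuous_const

theorem SemidirectProduct.continuous_inr {N G : Type*} [Group N] [Group G] [TopologicalSpace N]
    [TopologicalSpace G] {φ : G →* MulAut N} : Continuous (inr : G →* N ⋊[φ] G) :=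
  continuous_mk continuous_const continuous_id

variable {E F : Type*} [NormedAddCommGroup E] [NormedSpace ℝ E]
  [NormedAddCommGroup F] [NormedSpace ℝ F] {ω : E →L[ℝ] F →L[ℝ] ℝ}

/-- For a strong duality `ω` the group `H₊(ω)` is minimal. -/
theorem HeisenbergPlus.isMinimalGroup (hω : IsStrongDuality ω) :
    IsMinimalGroup (HeisenbergPlus ω) := by
  refine ⟨inferInstance, inferInstance, fun τ' h1 h2 hle => ?_⟩
  have h := @HeisenbergPlus.isInducing_of_continuous E F _ _ _ _ ω (HeisenbergPlus ω) _ τ' h1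
    (MonoidHom.id _) h2 hω (continuous_id_iff_le.2 hle) Function.injective_id
  obtain ⟨h⟩ := h
  exact induced_id.symm.trans h.symm

namespace Birepresentation

variable {G : Type*} [Group G] [TopologicalSpace G] (Ψ : Birepresentation G ω)

/-- The conjugation action of the induced group on its normal subgroup `H₊(ω)`. -/
noncomputable def conj (m : Ψ.InducedGroup) (h : HeisenbergPlus ω) : HeisenbergPlus ω :=
  (m * SemidirectProduct.inl h * m⁻¹).left

theorem inl_conj (m : Ψ.InducedGroup) (h : HeisenbergPlus ω) :
    SemidirectProduct.inl (Ψ.conj m h) = m * SemidirectProduct.inl h * m⁻¹ :=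
  SemidirectProduct.ext rfl (by simp)

theorem conj_eq (m : Ψ.InducedGroup) (h : HeisenbergPlus ω) :
    Ψ.conj m h = m.left * Ψ.inducedAction m.right h * m.left⁻¹ := by
  simp [conj]

theorem re_conj_ofReal (m : Ψ.InducedGroup) :
    (Ψ.conj m (HeisenbergPlus.ofReal ω 1)).re = m.left.pos := by
  have h : Ψ.inducedAction m.right (HeisenbergPlus.ofReal ω 1) = HeisenbergPlus.ofReal ω 1 :=
    HeisenbergPlus.ext_coords rfl (map_zero (Ψ.actE _)) (map_zero (Ψ.actF _)) rfl
  have := m.left.pos_pos.ne'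
  rw [conj_eq, h]
  simp [this, mul_add]
  ring

theorem coE_conj_ofE (m : Ψ.InducedGroup) (y : E) :
    (Ψ.conj m (HeisenbergPlus.ofE ω y)).coE = m.left.pos • Ψ.actE m.right y := by
  have h : Ψ.inducedAction m.right (HeisenbergPlus.ofE ω y) =
      HeisenbergPlus.ofE ω (Ψ.actE m.right y) :=
    HeisenbergPlus.ext_coords rfl rfl (map_zero (Ψ.actF _)) rfl
  have := m.left.pos_pos.ne'
  rw [conj_eq, h]
  simp [this]

theorem coF_conj_ofF (m : Ψ.InducedGroup) (f : F) :
    (Ψ.conj m (HeisenbergPlus.ofF ω f)).coF = Ψ.actF m.right f := by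
  have h : Ψ.inducedAction m.right (HeisenbergPlus.ofF ω f) =
      HeisenbergPlus.ofF ω (Ψ.actF m.right f) :=
    HeisenbergPlus.ext_coords rfl (map_zero (Ψ.actE _)) rfl rfl
  rw [conj_eq, h]
  simp

variable {Ψ}

/-- A coinduced topology along a surjective homomorphism is a group topology. -/
theorem isTopologicalGroup_coinduced {K H : Type*} [Group K] [Group H] [TopologicalSpace K]
    [IsTopologicalGroup K] (q : K →* H) (hq : Function.Surjective q) :
    @IsTopologicalGroup H (TopologicalSpace.coinduced q ‹_›) _ ∧
      @IsOpenQuotientMap K H _ (TopologicalSpace.coinduced q ‹_›) q := by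
  let := TopologicalSpace.coinduced q ‹_›
  have h : IsOpenQuotientMap q :=
    MonoidHom.isOpenQuotientMap_of_isQuotientMap ⟨⟨rfl⟩, hq⟩
  refine ⟨{ continuous_mul := ?_, continuous_inv := ?_ }, h⟩
  · refine (h.prodMap h).continuous_comp_iff.1 ?_
    simpa [Function.comp_def] using h.continuous.comp (continuous_mul (M := K))
  · refine h.continuous_comp_iff.1 ?_
    simpa [Function.comp_def] using h.continuous.comp (continuous_inv (G := K))

/-- A continuous isomorphism from the induced group of a t-exact birepresentation in a strong
duality onto a Hausdorff topological group is open. The topology of `H₊(ω)` being minimal, the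
conjugation action on `H₊(ω)` is continuous for the coarser topology; as it contains both
actions of `G`, the quotient topology on `G` is the given one. -/
theorem isInducing_of_continuous (hω : IsStrongDuality ω) (hΨ : Ψ.IsTExact)
    {K : Type*} [Group K] [TopologicalSpace K] [IsTopologicalGroup K] [T2Space K]
    (e : Ψ.InducedGroup ≃* K) (he : Continuous e) : IsInducing e := by
  let j : HeisenbergPlus ω →* K := e.toMonoidHom.comp SemidirectProduct.inl
  have hj : IsInducing j := HeisenbergPlus.isInducing_of_continuous hω
    (he.comp SemidirectProduct.continuous_inl)
    (e.injective.comp SemidirectProduct.inl_injective)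
  let q : K →* G := Ψ.projection.comp e.symm.toMonoidHom
  have hq : Function.Surjective q := SemidirectProduct.rightHom_surjective.comp e.symm.surjective
  obtain ⟨hgrp, hopen⟩ := isTopologicalGroup_coinduced q hq
  have hconj : Continuous fun p : K × HeisenbergPlus ω => Ψ.conj (e.symm p.1) p.2 := by
    refine hj.continuous_iff.2 ?_
    have h1 : (j ∘ fun p : K × HeisenbergPlus ω => Ψ.conj (e.symm p.1) p.2) =
        fun p : K × HeisenbergPlus ω => p.1 * j p.2 * p.1⁻¹ := by
      ext p
      simp [j, inl_conj]
    rw [h1]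
    exact (continuous_fst.mul (hj.continuous.comp continuous_snd)).mul continuous_fst.inv
  have hpos : Continuous fun k : K => (e.symm k).left.pos := by
    have h1 := HeisenbergPlus.continuous_re.comp
      (hconj.comp (Continuous.prodMk_left (HeisenbergPlus.ofReal ω 1)))
    simpa [Function.comp_def, re_conj_ofReal] using h1
  have hE : Continuous fun p : K × E => Ψ.actE (q p.1) p.2 := by
    have h1 := HeisenbergPlus.continuous_coE.comp
      (hconj.comp (continuous_id.prodMap HeisenbergPlus.continuous_ofE))
    have h2 := ((hpos.inv₀ fun k => (e.symm k).left.pos_pos.ne').comp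
      (continuous_fst (Y := E))).smul h1
    refine h2.congr fun p => ?_
    simp [coE_conj_ofE, smul_smul, inv_mul_cancel₀ (e.symm p.1).left.pos_pos.ne', q]
  have hF : Continuous fun p : K × F => Ψ.actF (q p.1) p.2 := by
    refine (HeisenbergPlus.continuous_coF.comp
      (hconj.comp (continuous_id.prodMap HeisenbergPlus.continuous_ofF))).congr fun p => ?_
    simp [coF_conj_ofF, q]
  have hτ := hΨ (TopologicalSpace.coinduced q ‹_›) hgrp ?_ ?_ ?_
  · have hqc : Continuous q := by
      rw [← hτ] 
      exact continuous_coinduced_rng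
    have hr : Continuous fun k : K => (e.symm k).right := hqc
    have hl : Continuous fun k : K => (e.symm k).left := by
      refine hj.continuous_iff.2 ?_
      have h1 : (j ∘ fun k : K => (e.symm k).left) =
          fun k : K => k * (e (SemidirectProduct.inr (e.symm k).right))⁻¹ := by
        ext k
        rw [eq_mul_inv_iff_mul_eq]
        simp [j, ← map_mul, SemidirectProduct.inl_left_mul_inr_right]
      rw [h1]
      exact continuous_id.mul (he.comp (SemidirectProduct.continuous_inr.comp hr)).inv
    have hs : Continuous e.symm := SemidirectProduct.continuous_mk hl hr
    exact (Homeomorph.mk e.toEquiv he hs).isInducing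
  · intro s hs
    have h1 := (isOpen_coinduced.1 hs).preimage
      (he.comp (SemidirectProduct.continuous_inr (φ := Ψ.inducedAction)))
    convert h1 using 1
    ext g
    simp [q]
  · let := TopologicalSpace.coinduced q ‹_›
    exact (hopen.prodMap .id).continuous_comp_iff.1 hE
  · let := TopologicalSpace.coinduced q ‹_›
    exact (hopen.prodMap .id).continuous_comp_iff.1 hF

/-- The induced group of a t-exact birepresentation in a strong duality is minimal. -/
theorem isMinimalGroup_inducedGroup [IsTopologicalGroup G] [T2Space G] (hω : IsStrongDuality ω)
    (hΨ : Ψ.IsTExact) : IsMinimalGroup Ψ.InducedGroup := by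
  refine ⟨inferInstance, inferInstance, fun τ' h1 h2 hle => ?_⟩
  have h := @isInducing_of_continuous E F _ _ _ _ ω G _ _ Ψ hω hΨ Ψ.InducedGroup _ τ' h1 h2
    (MulEquiv.refl _) (continuous_id_iff_le.2 hle)
  obtain ⟨h⟩ := h
  exact induced_id.symm.trans h.symm

end Birepresentation

end InducedGroup

/-! ### Completeness and solvability of semidirect products -/

section Completeness

open Filter Multiplicative

section Criteria

variable {G : Type*} [Group G] [TopologicalSpace G] [IsTopologicalGroup G]

theorem isWeilComplete_iff : IsWeilComplete G ↔ ∀ f : Filter G, f.NeBot →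
    Tendsto (fun p : G × G => p.2 * p.1⁻¹) (f ×ˢ f) (𝓝 1) → ∃ x, f ≤ 𝓝 x := by
  let _ : UniformSpace G := IsTopologicalGroup.rightUniformSpace G
  refine ⟨fun h f h1 h2 => ?_, fun h => ⟨fun {f} hf => h f hf.1 ?_⟩⟩
  · have : CompleteSpace G := h
    exact CompleteSpace.complete ⟨h1, tendsto_iff_comap.1 h2⟩
  · exact tendsto_iff_comap.2 hf.2

theorem isRaikovComplete_iff : IsRaikovComplete G ↔ ∀ f : Filter G, f.NeBot →
    Tendsto (fun p : G × G => p.1⁻¹ * p.2) (f ×ˢ f) (𝓝 1) →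
    Tendsto (fun p : G × G => p.2 * p.1⁻¹) (f ×ˢ f) (𝓝 1) → ∃ x, f ≤ 𝓝 x := by
  let u : UniformSpace G :=
    IsTopologicalGroup.leftUniformSpace G ⊓ IsTopologicalGroup.rightUniformSpace G
  have hu : u.toTopologicalSpace = ‹TopologicalSpace G› :=
    UniformSpace.toTopologicalSpace_inf.trans (inf_idem _)
  refine ⟨fun h f h1 h2 h3 => ?_, fun h => @CompleteSpace.mk G u fun {f} hf => ?_⟩
  · obtain ⟨x, hx⟩ := @CompleteSpace.complete G u h f
      ⟨h1, le_inf (tendsto_iff_comap.1 h2) (tendsto_iff_comap.1 h3)⟩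
    rw [hu] at hx
    exact ⟨x, hx⟩
  · rw [hu]
    exact h f hf.1 (tendsto_iff_comap.2 (hf.2.trans inf_le_left))
      (tendsto_iff_comap.2 (hf.2.trans inf_le_right))

theorem IsWeilComplete.congr {H : Type*} [Group H] [TopologicalSpace H] [IsTopologicalGroup H]
    (e : G ≃ₜ* H) (hG : IsWeilComplete G) : IsWeilComplete H := by
  refine isWeilComplete_iff.2 fun f hf h => ?_
  have hes : Tendsto (fun x => e.symm x) (𝓝 1) (𝓝 1) := by
    have := e.symm.continuous_toFun.tendsto 1
    rwa [show e.symm.toFun 1 = 1 from map_one e.symm] at this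
  obtain ⟨x, hx⟩ := isWeilComplete_iff.1 hG (f.map fun x => e.symm x) inferInstance (by
    rw [prod_map_map_eq, tendsto_map'_iff]
    refine (hes.comp h).congr fun p => ?_
    simp [map_mul, map_inv])
  refine ⟨e x, ?_⟩
  refine Tendsto.congr' (f₂ := id) (Eventually.of_forall fun y => ?_)
    ((e.continuous_toFun.tendsto x).comp (show Tendsto (fun x => e.symm x) f (𝓝 x) from hx))
  exact e.apply_symm_apply y

omit [IsTopologicalGroup G] in
theorem IsMinimalGroup.isInducing {H : Type*} [Group H] [TopologicalSpace H]
    [IsTopologicalGroup H] [T2Space H] (hG : IsMinimalGroup G) (e : G →* H) (he : Continuous e)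
    (hinj : Function.Injective e) : IsInducing e :=
  ⟨(hG.2.2 _ (topologicalGroup_induced e)
    (@T2Space.of_injective_continuous G H (TopologicalSpace.induced e ‹_›) _ _ e hinj
      continuous_induced_dom) (continuous_iff_le_induced.1 he)).symm⟩

omit [IsTopologicalGroup G] in
theorem IsMinimalGroup.congr {H : Type*} [Group H] [TopologicalSpace H]
    (e : G ≃ₜ* H) (hG : IsMinimalGroup G) : IsMinimalGroup H := by
  have h2 : T2Space G := hG.2.1
  have h1 : IsTopologicalGroup G := hG.1
  have h3 : _ = TopologicalSpace.induced e _ := e.toHomeomorph.isInducing.eq_induced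
  let e' : G →* H := e.toMulEquiv.toMonoidHom
  have he' : Continuous e' := e.continuous_toFun
  have hinj : Function.Injective e' := e.toMulEquiv.injective
  let g : H → G := e.symm
  have hsymm : e' ∘ g = id := funext e.apply_symm_apply
  have hind : ∀ t : TopologicalSpace H, (t.induced e').induced g = t := fun t => by
    rw [induced_compose, hsymm, induced_id]
  refine ⟨?_, e.toHomeomorph.t2Space, fun τ' h4 h5 hle => ?_⟩
  · have h6 : _ = TopologicalSpace.induced e.symm _ := e.symm.toHomeomorph.isInducing.eq_induced
    rw [h6]
    exact topologicalGroup_induced e.symm.toMulEquiv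
  · obtain ⟨h7⟩ := @IsMinimalGroup.isInducing G _ _ H _ τ' h4 h5 hG e'
      (continuous_le_rng hle he') hinj
    rw [← hind τ', ← h7, h3]
    exact hind _

end Criteria

/-- Complete normed spaces are Weil complete. -/
theorem isWeilComplete_multiplicative (V : Type*) [NormedAddCommGroup V] [CompleteSpace V] :
    IsWeilComplete (Multiplicative V) := by
  refine isWeilComplete_iff.2 fun f hf h => ?_
  have hc : Cauchy (α := V) f := by
    refine ⟨hf, ?_⟩
    rw [uniformity_eq_comap_nhds_zero V]
    refine tendsto_iff_comap.1 (Tendsto.congr (fun p => ?_) h)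
    exact (sub_eq_add_neg (G := V) p.2 p.1).symm
  exact CompleteSpace.complete (α := V) hc

theorem isWeilComplete_posReal : IsWeilComplete PosReal := by
  refine isWeilComplete_iff.2 fun f hf h => ?_
  have hc : Cauchy (f.map fun t : PosReal => Real.log t) := by
    refine ⟨inferInstance, ?_⟩
    rw [uniformity_eq_comap_nhds_zero ℝ, prod_map_map_eq, ← tendsto_iff_comap, tendsto_map'_iff]
    have h1 : Tendsto (fun t : PosReal => Real.log t) (𝓝 1) (𝓝 0) := by
      have h2 := (Real.continuousAt_log (one_ne_zero)).tendsto.comp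
        (continuous_subtype_val.tendsto (1 : PosReal))
      simpa [Function.comp_def] using h2
    refine (h1.comp h).congr fun p => ?_
    have h3 : ((p.2 * p.1⁻¹ : PosReal) : ℝ) = (p.2 : ℝ) * (p.1 : ℝ)⁻¹ := rfl
    simp [h3, Real.log_mul p.2.2.ne' (inv_ne_zero p.1.2.ne'), sub_eq_add_neg]
  obtain ⟨x, hx⟩ := CompleteSpace.complete hc
  refine ⟨⟨Real.exp x, Real.exp_pos x⟩, tendsto_subtype_rng.2 ?_⟩
  refine ((Real.continuous_exp.tendsto x).comp (show Tendsto _ f (𝓝 x) from hx)).congr fun t => ?_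
  exact Real.exp_log t.2

namespace SemidirectProduct

variable {N G : Type*} [Group N] [Group G] [TopologicalSpace N] [TopologicalSpace G]
  {φ : G →* MulAut N}

/-- A right Cauchy filter whose projection to `G` converges is convergent when `N` is Weil
complete. Writing its members as `m = g k` with `k ∈ N`, the filter of the `k` is right Cauchy
because `k₂ k₁⁻¹ = g₂⁻¹ (m₂ m₁⁻¹) g₁`. -/
theorem exists_le_nhds [IsTopologicalGroup N] [IsTopologicalGroup (N ⋊[φ] G)]
    (hN : IsWeilComplete N) {f : Filter (N ⋊[φ] G)} [f.NeBot]
    (hf : Tendsto (fun p : (N ⋊[φ] G) × (N ⋊[φ] G) => p.2 * p.1⁻¹) (f ×ˢ f) (𝓝 1)) {g : G}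
    (hg : Tendsto (fun m : N ⋊[φ] G => m.right) f (𝓝 g)) : ∃ x, f ≤ 𝓝 x := by
  have hi : Tendsto (fun m : N ⋊[φ] G => (inr m.right : N ⋊[φ] G)) f (𝓝 (inr g)) :=
    (continuous_inr.tendsto g).comp hg
  let k : N ⋊[φ] G → N := fun m => ((inr m.right)⁻¹ * m).left
  have hk : ∀ m, inl (k m) = (inr m.right)⁻¹ * m := fun m =>
    SemidirectProduct.ext rfl (by simp)
  obtain ⟨n, hn⟩ := isWeilComplete_iff.1 hN (f.map k) inferInstance (by
    rw [prod_map_map_eq, tendsto_map'_iff]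
    have h1 := ((hi.comp (tendsto_snd (f := f))).inv.mul hf).mul (hi.comp (tendsto_fst (g := f)))
    rw [mul_one, inv_mul_cancel] at h1
    refine ((continuous_left.tendsto (1 : N ⋊[φ] G)).comp h1).congr fun p => ?_
    rw [Function.comp_apply, ← left_inl (φ := φ) (((fun p : N × N => p.2 * p.1⁻¹) ∘ _) p)]
    congr 1
    simp only [Function.comp_apply, map_mul, map_inv, hk]
    group)
  refine ⟨inr g * inl n, ?_⟩
  have h2 := hi.mul ((continuous_inl (φ := φ)).tendsto n |>.comp (show Tendsto k f (𝓝 n) from hn))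
  refine Tendsto.congr' (f₂ := id) (Eventually.of_forall fun m => ?_) h2
  simp [hk]

section

variable [IsTopologicalGroup N] [IsTopologicalGroup G] [IsTopologicalGroup (N ⋊[φ] G)]

theorem isWeilComplete (hN : IsWeilComplete N) (hG : IsWeilComplete G) :
    IsWeilComplete (N ⋊[φ] G) := by
  refine isWeilComplete_iff.2 fun f hf h => ?_
  obtain ⟨g, hg⟩ := isWeilComplete_iff.1 hG (f.map right) inferInstance (by
    rw [prod_map_map_eq, tendsto_map'_iff]
    exact (continuous_right.tendsto (1 : N ⋊[φ] G)).comp h)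
  exact exists_le_nhds hN h hg

theorem isRaikovComplete (hN : IsWeilComplete N) (hG : IsRaikovComplete G) :
    IsRaikovComplete (N ⋊[φ] G) := by
  refine isRaikovComplete_iff.2 fun f hf h h' => ?_
  obtain ⟨g, hg⟩ := isRaikovComplete_iff.1 hG (f.map right) inferInstance
    (by
      rw [prod_map_map_eq, tendsto_map'_iff]
      exact (continuous_right.tendsto (1 : N ⋊[φ] G)).comp h)
    (by
      rw [prod_map_map_eq, tendsto_map'_iff]
      exact (continuous_right.tendsto (1 : N ⋊[φ] G)).comp h')
  exact exists_le_nhds hN h' hg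

end

omit [TopologicalSpace N] [TopologicalSpace G] in
theorem isSolvable [Group.IsSolvable N] [Group.IsSolvable G] : Group.IsSolvable (N ⋊[φ] G) :=
  Group.isSolvable_of_ker_le_range inl rightHom range_inl_eq_ker_rightHom.ge

variable (φ) in
/-- The normal factor of a semidirect product is the kernel of the projection, also as a
topological group. -/
noncomputable def kerEquiv : N ≃ₜ* (rightHom : N ⋊[φ] G →* G).ker where
  toFun n := ⟨inl n, rightHom_inl n⟩
  invFun m := m.1.left
  left_inv _ := rfl
  right_inv m := Subtype.ext (SemidirectProduct.ext rfl (Eq.symm (MonoidHom.mem_ker.1 m.2)))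
  map_mul' n n' := Subtype.ext ((inl (φ := φ)).map_mul n n')
  continuous_toFun := (continuous_inl (φ := φ)).subtype_mk _
  continuous_invFun := continuous_left.comp continuous_subtype_val

end SemidirectProduct

variable {E F : Type*} [NormedAddCommGroup E] [NormedSpace ℝ E]
  [NormedAddCommGroup F] [NormedSpace ℝ F] (ω : E →L[ℝ] F →L[ℝ] ℝ)

theorem HeisenbergPlus.isWeilComplete [CompleteSpace E] [CompleteSpace F] :
    IsWeilComplete (HeisenbergPlus ω) :=
  SemidirectProduct.isWeilComplete (SemidirectProduct.isWeilComplete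
    (isWeilComplete_multiplicative _) (isWeilComplete_multiplicative _)) isWeilComplete_posReal

theorem HeisenbergPlus.isSolvable : Group.IsSolvable (HeisenbergPlus ω) := by
  have : Group.IsSolvable PosReal := inferInstance
  have : Group.IsSolvable (Heisenberg ω) := SemidirectProduct.isSolvable
  exact SemidirectProduct.isSolvable

end Completeness

/-! ### Cardinal invariants of products and subspaces -/

section CardinalInvariants

open TopologicalSpace Filter

section Weight

variable (X : Type u) [TopologicalSpace X]

theorem aleph0_le_weight : ℵ₀ ≤ weight X := le_max_left _ _

theorem exists_isTopologicalBasis_mk_le_weight :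
    ∃ B : Set (Set X), IsTopologicalBasis B ∧ #B ≤ weight X := by
  obtain ⟨B, hB, h⟩ := csInf_mem
    (s := {κ | ∃ B : Set (Set X), IsTopologicalBasis B ∧ #B = κ})
    ⟨_, _, isTopologicalBasis_opens, rfl⟩
  exact ⟨B, hB, h.le.trans (le_max_right _ _)⟩

theorem exists_dense_mk_le_density : ∃ D : Set X, Dense D ∧ #D ≤ density X := by
  obtain ⟨D, hD, h⟩ := csInf_mem (s := {κ | ∃ D : Set X, Dense D ∧ #D = κ})
    ⟨_, _, dense_univ, rfl⟩
  exact ⟨D, hD, h.le.trans (le_max_right _ _)⟩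

variable {X}

theorem weight_le {κ : Cardinal.{u}} (hκ : ℵ₀ ≤ κ) {B : Set (Set X)}
    (hB : IsTopologicalBasis B) (h : #B ≤ κ) : weight X ≤ κ :=
  max_le hκ (le_trans (csInf_le' (show #B ∈ _ from ⟨B, hB, rfl⟩)) h)

theorem density_le {κ : Cardinal.{u}} (hκ : ℵ₀ ≤ κ) {D : Set X}
    (hD : Dense D) (h : #D ≤ κ) : density X ≤ κ :=
  max_le hκ (le_trans (csInf_le' (show #D ∈ _ from ⟨D, hD, rfl⟩)) h)

theorem density_le_weight : density X ≤ weight X := by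
  obtain ⟨B, hB, h⟩ := exists_isTopologicalBasis_mk_le_weight X
  let D : Set X := range fun U : {U : B // (U : Set X).Nonempty} => U.2.some
  refine density_le (D := D) (aleph0_le_weight X) (hB.dense_iff.2 fun U hU hne => ?_) ?_
  · exact ⟨_, hne.some_mem, ⟨⟨⟨U, hU⟩, hne⟩, rfl⟩⟩
  · exact mk_range_le.trans ((mk_subtype_le _).trans h)

theorem weight_le_of_isInducing {Y : Type u} [TopologicalSpace Y] {f : X → Y}
    (hf : IsInducing f) : weight X ≤ weight Y := by
  obtain ⟨B, hB, h⟩ := exists_isTopologicalBasis_mk_le_weight Y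
  exact weight_le (aleph0_le_weight Y) (hB.isInducing hf) (mk_image_le.trans h)

theorem weight_prod_le {Y : Type u} [TopologicalSpace Y] :
    weight (X × Y) ≤ max (weight X) (weight Y) := by
  obtain ⟨B, hB, h⟩ := exists_isTopologicalBasis_mk_le_weight X
  obtain ⟨B', hB', h'⟩ := exists_isTopologicalBasis_mk_le_weight Y
  have h0 : ℵ₀ ≤ max (weight X) (weight Y) := (aleph0_le_weight X).trans (le_max_left _ _)
  refine weight_le h0 (hB.prod hB') (mk_image2_le.trans ?_)
  exact mul_le_of_le h0 (h.trans (le_max_left _ _)) (h'.trans (le_max_right _ _))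

theorem weight_le_density {X : Type u} [PseudoMetricSpace X] : weight X ≤ density X := by
  obtain ⟨D, hD, h⟩ := exists_dense_mk_le_density X
  have h0 : ℵ₀ ≤ density X := le_max_left _ _
  let B : Set (Set X) := range fun p : D × ULift.{u} ℕ => Metric.ball p.1.1 (1 / (p.2.down + 1))
  refine weight_le (B := B) h0 (isTopologicalBasis_of_isOpen_of_nhds ?_ fun x U hx hU => ?_) ?_
  · rintro _ ⟨p, rfl⟩
    exact Metric.isOpen_ball
  · obtain ⟨ε, hε, hεU⟩ := Metric.isOpen_iff.1 hU x hx
    obtain ⟨n, hn⟩ := exists_nat_one_div_lt (half_pos hε)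
    obtain ⟨y, hy, hyx⟩ := hD.exists_dist_lt x (ε := 1 / ((n : ℝ) + 1)) (by positivity)
    refine ⟨_, ⟨(⟨y, hy⟩, ⟨n⟩), rfl⟩, hyx, fun z hz => hεU ?_⟩
    have h1 : dist z y < 1 / ((n : ℝ) + 1) := hz
    have h2 := dist_triangle z y x
    rw [dist_comm y x] at h2
    exact lt_of_le_of_lt h2 (by linarith)
  · refine mk_range_le.trans ?_
    rw [mk_prod, lift_id, lift_id]
    exact mul_le_of_le h0 h (by simpa using h0)

theorem density_prod_le {Y : Type u} [TopologicalSpace Y] :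
    density (X × Y) ≤ max (density X) (density Y) := by
  obtain ⟨D, hD, h⟩ := exists_dense_mk_le_density X
  obtain ⟨D', hD', h'⟩ := exists_dense_mk_le_density Y
  have h0 : ℵ₀ ≤ max (density X) (density Y) := (le_max_left _ _).trans (le_max_left _ _)
  refine density_le h0 (hD.prod hD') ?_
  rw [mk_setProd]
  exact mul_le_of_le h0 (h.trans (le_max_left _ _)) (h'.trans (le_max_right _ _))

theorem density_separable_prod_le {S : Type} [TopologicalSpace S] [SeparableSpace S] :
    density (S × X) ≤ density X := by
  obtain ⟨D, hD, h⟩ := exists_dense_mk_le_density X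
  obtain ⟨D', hD', h'⟩ := exists_countable_dense S
  have h0 : ℵ₀ ≤ density X := le_max_left _ _
  refine density_le h0 (h'.prod hD) ?_
  rw [mk_congr (Equiv.Set.prod D' D), mk_prod, Cardinal.lift_uzero]
  refine mul_le_of_le h0 (le_trans ?_ h0) h
  rw [lift_le_aleph0]
  exact hD'.le_aleph0

end Weight

section Character

variable {X Y : Type u} [TopologicalSpace X] [TopologicalSpace Y]

theorem exists_hasBasis_mk_eq_characterAt (x : X) :
    ∃ B : Set (Set X), (𝓝 x).HasBasis (fun U => U ∈ B) id ∧ #B = characterAt X x :=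
  csInf_mem (s := {κ | ∃ B : Set (Set X), (𝓝 x).HasBasis (fun U => U ∈ B) id ∧ #B = κ})
    ⟨_, _, (𝓝 x).basis_sets, rfl⟩

theorem characterAt_le {x : X} {B : Set (Set X)} (hB : (𝓝 x).HasBasis (fun U => U ∈ B) id) :
    characterAt X x ≤ #B :=
  csInf_le' (show #B ∈ _ from ⟨B, hB, rfl⟩)

theorem characterAt_le_character (x : X) : characterAt X x ≤ character X :=
  (le_ciSup (bddAbove_of_small) x).trans (le_max_right _ _)

theorem character_le {κ : Cardinal.{u}} (hκ : ℵ₀ ≤ κ) (h : ∀ x, characterAt X x ≤ κ) :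
    character X ≤ κ :=
  max_le hκ (ciSup_le' h)

theorem character_le_of_isInducing {f : X → Y} (hf : IsInducing f) :
    character X ≤ character Y := by
  refine character_le (le_max_left _ _) fun x => le_trans ?_ (characterAt_le_character (f x))
  obtain ⟨B, hB, h⟩ := exists_hasBasis_mk_eq_characterAt (f x)
  rw [← h]
  refine (characterAt_le (B := preimage f '' B) ?_).trans mk_image_le
  rw [hf.nhds_eq_comap]
  refine ⟨fun t => ((hB.comap f).mem_iff).trans ⟨?_, ?_⟩⟩
  · rintro ⟨U, hU, h'⟩
    exact ⟨_, ⟨U, hU, rfl⟩, h'⟩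
  · rintro ⟨_, ⟨U, hU, rfl⟩, h'⟩
    exact ⟨U, hU, h'⟩

theorem character_prod_le [FirstCountableTopology X] : character (X × Y) ≤ character Y := by
  refine character_le (le_max_left _ _) ?_
  rintro ⟨x, y⟩
  obtain ⟨B, hB, h⟩ := exists_hasBasis_mk_eq_characterAt y
  obtain ⟨V, hV⟩ := (𝓝 x).exists_antitone_basis
  have hp := hV.toHasBasis.prod_nhds hB
  have h0 : ℵ₀ ≤ character Y := le_max_left _ _
  refine (characterAt_le (B := range fun p : ULift.{u} ℕ × B => V p.1.down ×ˢ p.2.1) ?_).trans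
    (mk_range_le.trans ?_)
  · refine ⟨fun t => (hp.mem_iff).trans ⟨?_, ?_⟩⟩
    · rintro ⟨⟨n, U⟩, ⟨-, hU⟩, h'⟩
      exact ⟨_, ⟨(⟨n⟩, ⟨U, hU⟩), rfl⟩, h'⟩
    · rintro ⟨_, ⟨⟨n, U⟩, rfl⟩, h'⟩
      exact ⟨(n.down, U.1), ⟨trivial, U.2⟩, h'⟩
  · rw [mk_prod, lift_id, lift_id]
    exact mul_le_of_le h0 (by simpa using h0) (h.le.trans (characterAt_le_character y))

theorem exists_sInter_mk_eq_pseudocharacterAt [T1Space X] (x : X) :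
    ∃ B : Set (Set X), (∀ U ∈ B, IsOpen U) ∧ ⋂₀ B = {x} ∧ #B = pseudocharacterAt X x := by
  refine csInf_mem (s := {κ | ∃ B : Set (Set X), (∀ U ∈ B, IsOpen U) ∧ ⋂₀ B = {x} ∧ #B = κ})
    ⟨_, {U | IsOpen U ∧ x ∈ U}, fun U hU => hU.1, ?_, rfl⟩
  refine Subset.antisymm (fun y hy => ?_) ?_
  · by_contra hne
    exact hy {y}ᶜ ⟨isOpen_compl_singleton, fun h => hne h.symm⟩ rfl
  · rintro _ rfl U hU
    exact hU.2

theorem pseudocharacterAt_le {x : X} {B : Set (Set X)} (hB : ∀ U ∈ B, IsOpen U)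
    (hx : ⋂₀ B = {x}) : pseudocharacterAt X x ≤ #B :=
  csInf_le' (show #B ∈ _ from ⟨B, hB, hx, rfl⟩)

theorem pseudocharacterAt_le_pseudocharacter (x : X) :
    pseudocharacterAt X x ≤ pseudocharacter X :=
  (le_ciSup (bddAbove_of_small) x).trans (le_max_right _ _)

theorem pseudocharacter_le {κ : Cardinal.{u}} (hκ : ℵ₀ ≤ κ)
    (h : ∀ x, pseudocharacterAt X x ≤ κ) : pseudocharacter X ≤ κ :=
  max_le hκ (ciSup_le' h)

theorem pseudocharacter_le_of_injective [T1Space Y] {f : X → Y} (hf : Continuous f)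
    (hinj : Function.Injective f) : pseudocharacter X ≤ pseudocharacter Y := by
  refine pseudocharacter_le (le_max_left _ _) fun x =>
    le_trans ?_ (pseudocharacterAt_le_pseudocharacter (f x))
  obtain ⟨B, hB, hB', h⟩ := exists_sInter_mk_eq_pseudocharacterAt (f x)
  rw [← h]
  refine (pseudocharacterAt_le (B := preimage f '' B) ?_ ?_).trans mk_image_le
  · rintro _ ⟨U, hU, rfl⟩
    exact (hB U hU).preimage hf
  · rw [sInter_image, ← preimage_iInter₂, ← sInter_eq_biInter, hB', ← image_singleton,
      hinj.preimage_image]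

theorem pseudocharacter_prod_le [FirstCountableTopology X] [T1Space X] [T1Space Y] :
    pseudocharacter (X × Y) ≤ pseudocharacter Y := by
  refine pseudocharacter_le (le_max_left _ _) ?_
  rintro ⟨x, y⟩
  obtain ⟨B, hB, hB', h⟩ := exists_sInter_mk_eq_pseudocharacterAt y
  obtain ⟨V, hV, hV'⟩ := (nhds_basis_opens x).exists_antitone_subbasis
  have h0 : ℵ₀ ≤ pseudocharacter Y := le_max_left _ _
  refine (pseudocharacterAt_le (B := range (fun n : ULift.{u} ℕ => V n.down ×ˢ (univ : Set Y)) ∪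
    range (fun U : B => (univ : Set X) ×ˢ U.1)) ?_ ?_).trans ((mk_union_le _ _).trans ?_)
  · rintro _ (⟨n, rfl⟩ | ⟨U, rfl⟩)
    · exact (hV n.down).2.prod isOpen_univ
    · exact isOpen_univ.prod (hB _ U.2)
  · refine Subset.antisymm ?_ ?_
    · rintro ⟨a, b⟩ hab
      have ha : a = x := by
        by_contra hne
        obtain ⟨n, hn⟩ := hV'.mem_iff.1 (isOpen_compl_singleton.mem_nhds (Ne.symm hne))
        exact hn (hab _ (Or.inl ⟨⟨n⟩, rfl⟩)).1 rfl
      have hb : b ∈ ⋂₀ B := fun U hU => (hab _ (Or.inr ⟨⟨U, hU⟩, rfl⟩)).2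
      rw [hB'] at hb
      exact Prod.ext ha hb
    · rintro _ rfl _ (⟨n, rfl⟩ | ⟨U, rfl⟩)
      · exact ⟨(hV n.down).1, trivial⟩
      · have hy : y ∈ ⋂₀ B := by rw [hB']; rfl
        exact ⟨trivial, hy _ U.2⟩
  · refine add_le_of_le h0 (mk_range_le.trans (by simpa using h0)) (mk_range_le.trans ?_)
    exact h.le.trans (pseudocharacterAt_le_pseudocharacter y)

end Character

section InducedGroup

variable {E F G : Type u} [NormedAddCommGroup E] [NormedSpace ℝ E]
  [NormedAddCommGroup F] [NormedSpace ℝ F] {ω : E →L[ℝ] F →L[ℝ] ℝ}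
  [Group G] [TopologicalSpace G] (Ψ : Birepresentation G ω)

namespace Birepresentation

/-- The induced group is homeomorphic to the product of a metric space and `G`. -/
noncomputable def homeomorphProd : Ψ.InducedGroup ≃ₜ ((ℝ × PosReal) × (E × F)) × G where
  toFun m := (((m.left.re, m.left.right), (m.left.coE, m.left.coF)), m.right)
  invFun p := ⟨⟨⟨Multiplicative.ofAdd (p.1.1.1, p.1.2.1), Multiplicative.ofAdd p.1.2.2⟩,
    p.1.1.2⟩, p.2⟩
  left_inv _ := rfl
  right_inv _ := rfl
  continuous_toFun := by
    have hl : Continuous fun m : Ψ.InducedGroup => m.left := SemidirectProduct.continuous_left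
    exact (((HeisenbergPlus.continuous_re.comp hl).prodMk
      (SemidirectProduct.continuous_right.comp hl)).prodMk
      ((HeisenbergPlus.continuous_coE.comp hl).prodMk (HeisenbergPlus.continuous_coF.comp hl))).prodMk
      SemidirectProduct.continuous_right
  continuous_invFun := by
    refine SemidirectProduct.continuous_mk (SemidirectProduct.continuous_mk
      (SemidirectProduct.continuous_mk ?_ ?_) ?_) continuous_snd
    · exact continuous_ofAdd.comp (continuous_fst.fst.fst.prodMk continuous_fst.snd.fst)
    · exact continuous_ofAdd.comp continuous_fst.snd.snd
    · exact continuous_fst.fst.snd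

theorem isInducing_inclusion : IsInducing Ψ.inclusion :=
  .of_comp SemidirectProduct.continuous_inr SemidirectProduct.continuous_right .id

theorem weight_inducedGroup (h : max (density E) (density F) ≤ weight G) :
    weight Ψ.InducedGroup = weight G := by
  refine le_antisymm ?_ (weight_le_of_isInducing Ψ.isInducing_inclusion)
  refine (weight_le_of_isInducing Ψ.homeomorphProd.isInducing).trans (weight_prod_le.trans ?_)
  refine max_le (weight_le_density.trans ?_) le_rfl
  exact density_separable_prod_le.trans (density_prod_le.trans h)

theorem character_inducedGroup : character Ψ.InducedGroup = character G :=
  le_antisymm ((character_le_of_isInducing Ψ.homeomorphProd.isInducing).trans character_prod_le)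
    (character_le_of_isInducing Ψ.isInducing_inclusion)

theorem pseudocharacter_inducedGroup [T2Space G] :
    pseudocharacter Ψ.InducedGroup = pseudocharacter G :=
  le_antisymm ((pseudocharacter_le_of_injective Ψ.homeomorphProd.continuous
      Ψ.homeomorphProd.injective).trans pseudocharacter_prod_le)
    (pseudocharacter_le_of_injective Ψ.isInducing_inclusion.continuous
      SemidirectProduct.inr_injective)

end Birepresentation

end InducedGroup

end CardinalInvariants

/-! ### Isometric actions on closed spans of orbits -/

section OrbitSpan

open Filter

variable {G V I : Type*} [Group G] [NormedAddCommGroup V] [NormedSpace ℝ V]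
  (α : G →* (V ≃ₗᵢ[ℝ] V)) (v : I → V)

/-- The closed linear span of the orbits of the vectors `v i`. -/
def orbitSpan : Submodule ℝ V :=
  (Submodule.span ℝ (range fun p : G × I => α p.1 (v p.2))).topologicalClosure

theorem isClosed_orbitSpan : IsClosed (orbitSpan α v : Set V) :=
  Submodule.isClosed_topologicalClosure _

theorem mem_orbitSpan (g : G) (i : I) : α g (v i) ∈ orbitSpan α v :=
  Submodule.le_topologicalClosure _ (Submodule.subset_span ⟨(g, i), rfl⟩)

theorem self_mem_orbitSpan (i : I) : v i ∈ orbitSpan α v := by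
  simpa using mem_orbitSpan α v 1 i

variable {α v} in
theorem orbitSpan_le {W : Submodule ℝ V} (hW : IsClosed (W : Set V))
    (h : ∀ g i, α g (v i) ∈ W) : orbitSpan α v ≤ W :=
  Submodule.topologicalClosure_minimal _
    (Submodule.span_le.2 (range_subset_iff.2 fun p => h p.1 p.2)) hW

theorem map_mem_orbitSpan (g : G) {x : V} (hx : x ∈ orbitSpan α v) : α g x ∈ orbitSpan α v := by
  refine orbitSpan_le (W := (orbitSpan α v).comap (α g).toLinearEquiv.toLinearMap) ?_
    (fun h i => ?_) hx
  · exact (isClosed_orbitSpan α v).preimage (α g).continuous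
  · have := mem_orbitSpan α v (g * h) i
    rwa [map_mul] at this

/-- The restriction of an isometric action to the closed span of some orbits. -/
noncomputable def orbitAction : G →* (orbitSpan α v ≃ₗᵢ[ℝ] orbitSpan α v) where
  toFun g :=
    { toFun := fun x => ⟨α g x, map_mem_orbitSpan α v g x.2⟩
      invFun := fun x => ⟨α g⁻¹ x, map_mem_orbitSpan α v g⁻¹ x.2⟩
      left_inv := fun x => by ext; simp
      right_inv := fun x => by ext; simp
      map_add' := fun x y => by ext; simp
      map_smul' := fun r x => by ext; simp
      norm_map' := fun x => (α g).norm_map x }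
  map_one' := by ext x; simp
  map_mul' g h := by ext x; simp

@[simp] theorem coe_orbitAction (g : G) (x : orbitSpan α v) :
    (orbitAction α v g x : V) = α g x := rfl

/-- An isometric action is jointly continuous as soon as all orbit maps are continuous at the
identity. -/
theorem isContinuousAction_of_tendsto [τ : TopologicalSpace G] [IsTopologicalGroup G]
    (h : ∀ x, Tendsto (fun g => α g x) (𝓝 1) (𝓝 x)) : IsContinuousAction τ α := by
  refine continuous_iff_continuousAt.2 fun ⟨g₀, x₀⟩ => ?_
  have h1 : Tendsto (fun p : G × V => α (g₀⁻¹ * p.1) x₀) (𝓝 (g₀, x₀)) (𝓝 x₀) := by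
    refine (h x₀).comp ?_
    have : Continuous fun p : G × V => g₀⁻¹ * p.1 := by fun_prop
    exact this.tendsto' _ _ (by simp)
  have h2 : Tendsto (fun p : G × V => ‖α (g₀⁻¹ * p.1) x₀ - x₀‖ + ‖p.2 - x₀‖) (𝓝 (g₀, x₀))
      (𝓝 0) := by
    have h3 : Tendsto (fun p : G × V => ‖p.2 - x₀‖) (𝓝 (g₀, x₀)) (𝓝 0) := by
      have : Continuous fun p : G × V => ‖p.2 - x₀‖ := by fun_prop
      exact this.tendsto' _ _ (by simp)
    simpa using (tendsto_iff_norm_sub_tendsto_zero.1 h1).add h3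
  refine tendsto_iff_norm_sub_tendsto_zero.2 (squeeze_zero (fun _ => norm_nonneg _) ?_ h2)
  rintro ⟨g, x⟩
  have h4 : α g x - α g₀ x₀ = α g₀ (α (g₀⁻¹ * g) x₀ - x₀) + α g (x - x₀) := by
    simp [map_mul]
  dsimp only
  rw [h4]
  refine (norm_add_le _ _).trans ?_
  rw [(α g₀).norm_map, (α g).norm_map]

variable {α} in
theorem IsContinuousAction.continuous_orbit {τ : TopologicalSpace G} (h : IsContinuousAction τ α)
    (x : V) : Continuous fun g => α g x := by
  have h' : Continuous fun p : G × V => α p.1 p.2 := h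
  exact h'.comp (Continuous.prodMk_left x)

theorem tendsto_orbitAction [TopologicalSpace G] [IsTopologicalGroup G]
    (h : ∀ i, Tendsto (fun g => α g (v i)) (𝓝 1) (𝓝 (v i))) (x : orbitSpan α v) :
    Tendsto (fun g => orbitAction α v g x) (𝓝 1) (𝓝 x) := by
  let W : Submodule ℝ V :=
    { carrier := {x | Tendsto (fun g => α g x) (𝓝 1) (𝓝 x)}
      zero_mem' := by simp
      add_mem' := fun hx hy => by simpa using Tendsto.add hx hy
      smul_mem' := fun r x hx => by simpa using Tendsto.const_smul hx r }
  have hW : IsClosed (W : Set V) := by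
    refine isClosed_of_closure_subset fun x hx => Metric.tendsto_nhds.2 fun ε hε => ?_
    obtain ⟨y, hy, hxy⟩ := Metric.mem_closure_iff.1 hx (ε / 3) (by positivity)
    filter_upwards [Metric.tendsto_nhds.1 hy (ε / 3) (by positivity)] with g hg
    have h1 := dist_triangle4 (α g x) (α g y) y x
    rw [(α g).dist_map, dist_comm y x] at h1
    linarith
  have hx : (x : V) ∈ W := by
    refine orbitSpan_le hW (fun k i => ?_) x.2
    have h1 : Tendsto (fun g : G => k⁻¹ * g * k) (𝓝 1) (𝓝 1) := by
      have : Continuous fun g : G => k⁻¹ * g * k := by fun_prop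
      exact this.tendsto' _ _ (by simp)
    have h2 := ((α k).continuous.tendsto (v i)).comp ((h i).comp h1)
    refine h2.congr fun g => ?_
    simp [map_mul]
  exact tendsto_subtype_rng.2 hx

variable {α v} in
theorem isContinuousAction_orbitAction [τ : TopologicalSpace G] [IsTopologicalGroup G]
    (h : ∀ i, Tendsto (fun g => α g (v i)) (𝓝 1) (𝓝 (v i))) :
    IsContinuousAction τ (orbitAction α v) :=
  isContinuousAction_of_tendsto _ (tendsto_orbitAction _ _ h)

theorem density_orbitSpan_le {G V I : Type u} [Group G] [NormedAddCommGroup V] [NormedSpace ℝ V]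
    [TopologicalSpace G] [IsTopologicalGroup G] {α : G →* (V ≃ₗᵢ[ℝ] V)} {v : I → V}
    (h : ∀ i, Tendsto (fun g => α g (v i)) (𝓝 1) (𝓝 (v i))) {κ : Cardinal.{u}} (hG : density G ≤ κ)
    (hI : #I ≤ κ) : density (orbitSpan α v) ≤ κ := by
  have hκ : ℵ₀ ≤ κ := (le_max_left _ _).trans hG
  have hα : ∀ i, Continuous fun g => α g (v i) := fun i => continuous_subtype_val.comp
    ((isContinuousAction_orbitAction h).continuous_orbit ⟨v i, self_mem_orbitSpan α v i⟩)
  obtain ⟨D, hD, hDκ⟩ := exists_dense_mk_le_density G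
  let f : ULift.{u} ℚ × D × I → V := fun p => ((p.1.down : ℚ) : ℝ) • α p.2.1 (v p.2.2)
  let s : List (ULift.{u} ℚ × D × I) → V := fun l => (l.map f).sum
  have hfr : ∀ (r : ℝ) (l : List (ULift.{u} ℚ × D × I)), r • s l ∈ closure (range s) := by
    intro r l
    have hq : ∀ q : ℚ, (q : ℝ) • s l ∈ range s := fun q => by
      refine ⟨l.map fun p => (⟨q * p.1.down⟩, p.2), ?_⟩
      simp only [s, f, List.smul_sum, List.map_map, Function.comp_def, smul_smul]
      push_cast
      rfl
    have hc : Continuous fun r : ℝ => r • s l := by fun_prop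
    exact map_mem_closure (f := fun r : ℝ => r • s l) hc (Rat.isDenseEmbedding_coe_real.dense r)
      (by rintro _ ⟨q, rfl⟩; exact hq q)
  let W : Submodule ℝ V :=
    { carrier := closure (range s)
      zero_mem' := subset_closure ⟨[], by simp [s]⟩
      add_mem' := fun hx hy => map_mem_closure₂ continuous_add hx hy (by
        rintro _ ⟨l, rfl⟩ _ ⟨l', rfl⟩
        exact ⟨l ++ l', by simp [s]⟩)
      smul_mem' := fun r x hx => by
        have := map_mem_closure (continuous_const_smul r) hx
          (t := closure (range s)) (by rintro _ ⟨l, rfl⟩; exact hfr r l)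
        rwa [closure_closure] at this }
  have hle : orbitSpan α v ≤ W := by
    refine orbitSpan_le isClosed_closure fun g i => ?_
    refine map_mem_closure (f := fun g => α g (v i)) (hα i) (hD g) fun d hd => ⟨[(⟨1⟩, ⟨d, hd⟩, i)], ?_⟩
    simp [s, f]
  have hs : ∀ l, s l ∈ orbitSpan α v := fun l => by
    refine list_sum_mem fun x hx => ?_
    obtain ⟨p, -, rfl⟩ := List.mem_map.1 hx
    exact Submodule.smul_mem _ _ (mem_orbitSpan α v _ _)
  refine density_le hκ (D := range fun l => (⟨s l, hs l⟩ : orbitSpan α v)) (fun x => ?_) ?_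
  · rw [IsInducing.subtypeVal.closure_eq_preimage_closure_image, ← range_comp]
    exact hle x.2
  · refine mk_range_le.trans ((mk_list_le_max _).trans (max_le hκ ?_))
    rw [mk_prod, mk_prod]
    simp only [lift_id]
    exact mul_le_of_le hκ (by simpa using hκ) (mul_le_of_le hκ (hDκ.trans hG) hI)

end OrbitSpan

/-! ### A t-exact birepresentation in a strong duality -/

section Construction

open Filter
open scoped ENNReal

/-- The dual of a normed space. It is not reducible to the type of continuous linear maps, so
that its normed space structure is the only one that is found on its subspaces. -/
def NormedDual (E : Type*) [NormedAddCommGroup E] [NormedSpace ℝ E] : Type _ := E →L[ℝ] ℝ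

namespace NormedDual

variable {E : Type*} [NormedAddCommGroup E] [NormedSpace ℝ E]

noncomputable instance : NormedAddCommGroup (NormedDual E) :=
  inferInstanceAs (NormedAddCommGroup (E →L[ℝ] ℝ))

noncomputable instance : NormedSpace ℝ (NormedDual E) :=
  inferInstanceAs (NormedSpace ℝ (E →L[ℝ] ℝ))

instance : CompleteSpace (NormedDual E) :=
  inferInstanceAs (CompleteSpace (E →L[ℝ] ℝ))

/-- A continuous linear functional as an element of the dual. -/
def of (ψ : E →L[ℝ] ℝ) : NormedDual E := ψ

/-- The evaluation pairing. -/
noncomputable def eval : E →L[ℝ] NormedDual E →L[ℝ] ℝ :=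
  (ContinuousLinearMap.id ℝ (E →L[ℝ] ℝ)).flip

theorem ext {ψ ψ' : NormedDual E} (h : ∀ x, eval x ψ = eval x ψ') : ψ = ψ' :=
  ContinuousLinearMap.ext h

theorem abs_eval_le (x : E) (ψ : NormedDual E) : |eval x ψ| ≤ ‖ψ‖ * ‖x‖ :=
  ContinuousLinearMap.le_opNorm (𝕜 := ℝ) (E := E) (F := ℝ) ψ x

theorem norm_le {ψ : NormedDual E} {C : ℝ} (hC : 0 ≤ C) (h : ∀ x, |eval x ψ| ≤ C * ‖x‖) :
    ‖ψ‖ ≤ C :=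
  ContinuousLinearMap.opNorm_le_bound (𝕜 := ℝ) (E := E) (F := ℝ) ψ hC h

theorem norm_le_of_unit {ψ : NormedDual E} {C : ℝ} (hC : 0 ≤ C)
    (h : ∀ x, ‖x‖ = 1 → |eval x ψ| ≤ C) : ‖ψ‖ ≤ C :=
  ContinuousLinearMap.opNorm_le_of_unit_norm (E := E) (F := ℝ) (f := ψ) hC fun {x} => h x

end NormedDual

/-- The action on the dual space that is contragredient to an isometric action. -/
noncomputable def dualAction {G E : Type*} [Group G] [NormedAddCommGroup E] [NormedSpace ℝ E]
    (ρ : G →* (E ≃ₗᵢ[ℝ] E)) : G →* (NormedDual E ≃ₗᵢ[ℝ] NormedDual E) where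
  toFun g :=
    let c : G → NormedDual E → NormedDual E := fun g ψ =>
      ContinuousLinearMap.comp (M₂ := E) ψ (ρ g⁻¹ : E →L[ℝ] E)
    have hc' : ∀ g ψ, c g⁻¹ (c g ψ) = ψ := fun g ψ => NormedDual.ext fun x => by
      change NormedDual.eval (ρ g⁻¹ (ρ g⁻¹⁻¹ x)) ψ = _
      simp
    { toFun := c g
      invFun := c g⁻¹
      left_inv := hc' g
      right_inv := fun ψ => by simpa using hc' g⁻¹ ψ
      map_add' := fun ψ ψ' => rfl
      map_smul' := fun r ψ => rfl
      norm_map' := fun ψ =>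
        ContinuousLinearMap.opNorm_comp_linearIsometryEquiv (F := E) (G := ℝ) ψ (ρ g⁻¹) }
  map_one' := by
    ext ψ
    refine NormedDual.ext fun x => ?_
    change NormedDual.eval (ρ 1⁻¹ x) ψ = NormedDual.eval x ψ
    simp
  map_mul' g h := by
    ext ψ
    refine NormedDual.ext fun x => ?_
    change NormedDual.eval (ρ (g * h)⁻¹ x) ψ = NormedDual.eval (ρ h⁻¹ (ρ g⁻¹ x)) ψ
    simp

theorem eval_dualAction {G E : Type*} [Group G] [NormedAddCommGroup E] [NormedSpace ℝ E]
    (ρ : G →* (E ≃ₗᵢ[ℝ] E)) (g : G) (ψ : NormedDual E) (x : E) :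
    NormedDual.eval x (dualAction ρ g ψ) = NormedDual.eval (ρ g⁻¹ x) ψ := rfl

/-- A group of permutations of `T` acts isometrically on the bounded functions on `T`. -/
noncomputable def lpAction {G T : Type*} [Group G] (σ : G →* Equiv.Perm T) :
    G →* (lp (fun _ : T => ℝ) ∞ ≃ₗᵢ[ℝ] lp (fun _ : T => ℝ) ∞) where
  toFun g :=
    let c : G → lp (fun _ : T => ℝ) ∞ → lp (fun _ : T => ℝ) ∞ := fun g φ =>
      ⟨fun t => φ (σ g⁻¹ t), memℓp_infty (by
        obtain ⟨C, hC⟩ := (lp.memℓp φ).bddAbove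
        exact ⟨C, by rintro _ ⟨t, rfl⟩; exact hC ⟨_, rfl⟩⟩)⟩
    have hc : ∀ g φ, ‖c g φ‖ ≤ ‖φ‖ := fun g φ =>
      lp.norm_le_of_forall_le (norm_nonneg _) fun t =>
        lp.norm_apply_le_norm ENNReal.top_ne_zero φ (σ g⁻¹ t)
    have hc' : ∀ g φ, c g⁻¹ (c g φ) = φ := fun g φ => by
      ext t
      change φ (σ g⁻¹ (σ g⁻¹⁻¹ t)) = φ t
      simp
    { toFun := c g
      invFun := c g⁻¹
      left_inv := hc' g
      right_inv := fun φ => by simpa using hc' g⁻¹ φ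
      map_add' := fun φ φ' => rfl
      map_smul' := fun r φ => rfl
      norm_map' := fun φ => le_antisymm (hc g φ) (by
        have := hc g⁻¹ (c g φ)
        rwa [hc'] at this) }
  map_one' := by
    ext φ t
    change φ (σ 1⁻¹ t) = φ t
    simp
  map_mul' g h := by
    ext φ t
    change φ (σ (g * h)⁻¹ t) = φ (σ h⁻¹ (σ g⁻¹ t))
    simp

theorem lpAction_apply {G T : Type*} [Group G] (σ : G →* Equiv.Perm T) (g : G)
    (φ : lp (fun _ : T => ℝ) ∞) (t : T) : lpAction σ g φ t = φ (σ g⁻¹ t) := rfl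

theorem evalCLM_apply {T : Type*} (t : T) (φ : lp (fun _ : T => ℝ) ∞) :
    lp.evalCLM ℝ (fun _ : T => ℝ) ∞ t φ = φ t := rfl

section DualPairing

variable {E : Type*} [NormedAddCommGroup E] [NormedSpace ℝ E]

/-- The evaluation pairing of a normed space with a subspace of its dual. -/
noncomputable def dualPairing (F : Submodule ℝ (NormedDual E)) : E →L[ℝ] F →L[ℝ] ℝ :=
  (NormedDual.eval.flip.comp F.subtypeL).flip

theorem dualPairing_apply (F : Submodule ℝ (NormedDual E)) (x : E) (ψ : F) :
    dualPairing F x ψ = NormedDual.eval x ψ.1 := rfl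

theorem isRegularForm_dualPairing (F : Submodule ℝ (NormedDual E)) :
    IsRegularForm (dualPairing F) := fun x ψ => by
  rw [dualPairing_apply, mul_comm]
  exact NormedDual.abs_eval_le x ψ.1

/-- The pairing with a norming subspace of the dual is a strong duality. -/
theorem isStrongDuality_dualPairing {F : Submodule ℝ (NormedDual E)}
    (hF : ∀ (x : E) (C : ℝ), 0 ≤ C → (∀ ψ ∈ F, ‖ψ‖ ≤ 1 → |NormedDual.eval x ψ| ≤ C) → ‖x‖ ≤ C) :
    IsStrongDuality (dualPairing F) where
  left_strong x hx hb := by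
    obtain ⟨C, hC⟩ := hb.exists_norm_le
    refine hx (isBounded_iff_forall_norm_le.2 ⟨max C 0, ?_⟩)
    rintro _ ⟨n, rfl⟩
    exact hF _ _ (le_max_right _ _) fun ψ hψF hψ =>
      (hC _ ⟨n, ⟨ψ, hψF⟩, hψ, rfl⟩).trans (le_max_left _ _)
  right_strong ψ hψ hb := by
    obtain ⟨C, hC⟩ := hb.exists_norm_le
    refine hψ (isBounded_iff_forall_norm_le.2 ⟨max C 0, ?_⟩)
    rintro _ ⟨n, rfl⟩
    exact NormedDual.norm_le_of_unit (le_max_right _ _) fun x hx =>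
      (hC _ ⟨n, x, hx.le, rfl⟩).trans (le_max_left _ _)

/-- A continuous isometric action and the contragredient action on the closed span of orbits of
functionals form a birepresentation, if the orbit maps of these functionals are continuous. -/
noncomputable def dualBirepresentation {G I : Type*} [Group G] [τ : TopologicalSpace G]
    [IsTopologicalGroup G] {ρ : G →* (E ≃ₗᵢ[ℝ] E)} (hρ : IsContinuousAction τ ρ)
    {w : I → NormedDual E}
    (hw : ∀ i, Tendsto (fun g => dualAction ρ g (w i)) (𝓝 1) (𝓝 (w i))) :
    Birepresentation G (dualPairing (orbitSpan (dualAction ρ) w)) where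
  actE := ρ
  actF := orbitAction (dualAction ρ) w
  continuous_actE := hρ
  continuous_actF := isContinuousAction_orbitAction hw
  invariant g x ψ := by
    rw [dualPairing_apply, coe_orbitAction, eval_dualAction, dualPairing_apply]
    simp

end DualPairing

namespace HolderSpace

variable {G I : Type u} [Group G]

/-- The index set on which a family of functions `φ i : G → ℝ` is recorded through its values
`φ i x`, at `(i, x)`, and its Hölder quotients, at `(i, x, y)`. -/
abbrev Index (I G : Type u) : Type u := (I × G) ⊕ (I × G × G)

/-- Left translation on the index set. -/
def translation : G →* Equiv.Perm (Index I G) where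
  toFun g := Equiv.sumCongr (Equiv.prodCongr (Equiv.refl I) (Equiv.mulLeft g))
    (Equiv.prodCongr (Equiv.refl I) (Equiv.prodCongr (Equiv.mulLeft g) (Equiv.mulLeft g)))
  map_one' := by ext (⟨i, x⟩ | ⟨i, x, y⟩) <;> simp
  map_mul' g h := by ext (⟨i, x⟩ | ⟨i, x, y⟩) <;> simp [mul_assoc]

theorem translation_inl (g : G) (i : I) (x : G) :
    translation g (Sum.inl (i, x)) = (Sum.inl (i, g * x) : Index I G) := rfl

theorem translation_inr (g : G) (i : I) (x y : G) :
    translation g (Sum.inr (i, x, y)) = (Sum.inr (i, g * x, g * y) : Index I G) := rfl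

variable {N : I → GroupSeminorm G}

open Classical in
variable (N) in
/-- The values and the Hölder quotients of exponent `1 / 2`, with respect to the left-invariant
pseudometrics `N j (x⁻¹ * y)`, of the family that is `N i` at the index `i` and zero elsewhere.
A quotient with denominator zero counts as zero. -/
noncomputable def basicFun (i : I) : Index I G → ℝ
  | Sum.inl (j, x) => if j = i then N i x else 0
  | Sum.inr (j, x, y) => if j = i then (N i x - N i y) / √(N i (x⁻¹ * y)) else 0

theorem abs_div_sqrt_le {a b c : ℝ} (ha : 0 ≤ a) (hca : |c| ≤ 2 * a) (hcb : |c| ≤ 2 * b) :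
    |c / √a| ≤ 2 * √b := by
  rw [abs_div, abs_of_nonneg (Real.sqrt_nonneg a)]
  refine div_le_of_le_mul₀ (Real.sqrt_nonneg _) (by positivity) ?_
  have hb : 0 ≤ b := by linarith [abs_nonneg c]
  have h1 := Real.mul_self_sqrt ha
  have h2 := Real.mul_self_sqrt hb
  rcases le_total a b with h | h
  · have h3 := mul_le_mul_of_nonneg_right (Real.sqrt_le_sqrt h) (Real.sqrt_nonneg a)
    linarith
  · have h3 := mul_le_mul_of_nonneg_left (Real.sqrt_le_sqrt h) (Real.sqrt_nonneg b)
    linarith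

theorem le_sqrt_of_le_one {a : ℝ} (h0 : 0 ≤ a) (h1 : a ≤ 1) : a ≤ √a :=
  Real.le_sqrt_of_sq_le (by nlinarith)

theorem abs_basicFun_le (hN : ∀ i g, N i g ≤ 1) (i : I) (t : Index I G) :
    |basicFun N i t| ≤ 2 := by
  rcases t with ⟨j, x⟩ | ⟨j, x, y⟩
  · simp only [basicFun]
    split_ifs
    · rw [abs_of_nonneg (apply_nonneg _ _)]
      linarith [hN i x]
    · simp
  · simp only [basicFun]
    split_ifs
    · have h1 := (N i).abs_sub_le_inv_mul x y
      have h2 := hN i (x⁻¹ * y)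
      have h0 : 0 ≤ N i (x⁻¹ * y) := apply_nonneg _ _
      simpa using abs_div_sqrt_le h0 (c := N i x - N i y) (b := 1) (by linarith) (by linarith)
    · simp

/-- The basic functions as elements of the space of bounded functions. -/
noncomputable def basic (hN : ∀ i g, N i g ≤ 1) (i : I) : lp (fun _ : Index I G => ℝ) ∞ :=
  ⟨basicFun N i, memℓp_infty ⟨2, by rintro _ ⟨t, rfl⟩; exact abs_basicFun_le hN i t⟩⟩

theorem basic_apply (hN : ∀ i g, N i g ≤ 1) (i : I) (t : Index I G) :
    basic hN i t = basicFun N i t := rfl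

/-- Since `|N (g⁻¹ x) - N x|` is at most `N g` and the differences of `N` are at most
`N (x⁻¹ y)`, the Hölder quotients of exponent `1 / 2` are at most `2 √(N g)`. -/
theorem norm_translate_basic_sub_le (hN : ∀ i g, N i g ≤ 1) (i : I) (g : G) :
    ‖lpAction translation g (basic hN i) - basic hN i‖ ≤ 2 * √(N i g) := by
  refine lp.norm_le_of_forall_le (by positivity) fun t => ?_
  have h1 : (lpAction translation g (basic hN i) - basic hN i : lp _ ∞) t =
    basicFun N i (translation g⁻¹ t) - basicFun N i t := rfl
  rw [h1, Real.norm_eq_abs]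
  rcases t with ⟨j, x⟩ | ⟨j, x, y⟩
  · rw [translation_inl]
    simp only [basicFun]
    split_ifs
    · have h2 := (N i).abs_inv_mul_sub_le g x
      have h3 := le_sqrt_of_le_one (apply_nonneg (N i) g) (hN i g)
      linarith [Real.sqrt_nonneg (N i g)]
    · simp
  · rw [translation_inr]
    simp only [basicFun]
    split_ifs
    · have h2 : (g⁻¹ * x)⁻¹ * (g⁻¹ * y) = x⁻¹ * y := by group
      have hx := (N i).abs_inv_mul_sub_le g x
      have hy := (N i).abs_inv_mul_sub_le g y
      have h3 := (N i).abs_sub_le_inv_mul x y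
      have h4 := (N i).abs_sub_le_inv_mul (g⁻¹ * x) (g⁻¹ * y)
      rw [h2] at h4 ⊢
      rw [← sub_div]
      rw [abs_le] at hx hy h3 h4
      refine abs_div_sqrt_le (apply_nonneg _ _) ?_ ?_ <;> rw [abs_le] <;> constructor <;> linarith
    · simp

variable (hN : ∀ i g, N i g ≤ 1)

/-- The closed span of the translates of the basic functions. -/
noncomputable abbrev space : Submodule ℝ (lp (fun _ : Index I G => ℝ) ∞) :=
  orbitSpan (lpAction translation) (basic hN)

/-- The action of `G` on the space by left translation. -/
noncomputable abbrev action : G →* (space hN ≃ₗᵢ[ℝ] space hN) :=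
  orbitAction (lpAction translation) (basic hN)

theorem evalCLM_eq_of_basic {A B : lp (fun _ : Index I G => ℝ) ∞ →L[ℝ] ℝ}
    (h : ∀ g i, A (lpAction translation g (basic hN i)) = B (lpAction translation g (basic hN i)))
    (φ : space hN) : A φ = B φ := by
  have h1 : (φ : lp (fun _ : Index I G => ℝ) ∞) ∈ LinearMap.ker (A - B).toLinearMap :=
    orbitSpan_le (ContinuousLinearMap.isClosed_ker (A - B)) (fun g i => by
      simpa [sub_eq_zero] using h g i) φ.2
  simpa [sub_eq_zero] using h1

theorem apply_inr (φ : space hN) (j : I) (x y : G) :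
    φ.1 (Sum.inr (j, x, y)) =
      (√(N j (x⁻¹ * y)))⁻¹ * (φ.1 (Sum.inl (j, x)) - φ.1 (Sum.inl (j, y))) := by
  refine evalCLM_eq_of_basic hN (A := lp.evalCLM ℝ (fun _ : Index I G => ℝ) ∞ (Sum.inr (j, x, y)))
    (B := (√(N j (x⁻¹ * y)))⁻¹ • (lp.evalCLM ℝ (fun _ : Index I G => ℝ) ∞ (Sum.inl (j, x)) - lp.evalCLM ℝ (fun _ : Index I G => ℝ) ∞ (Sum.inl (j, y))))
    (fun g i => ?_) φ
  have h2 : (g⁻¹ * x)⁻¹ * (g⁻¹ * y) = x⁻¹ * y := by group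
  simp only [evalCLM_apply, smul_apply, sub_apply, smul_eq_mul, lpAction_apply, translation_inl,
    translation_inr, basic_apply, basicFun, h2]
  split_ifs with h
  · subst h
    rw [div_eq_inv_mul]
  · simp

theorem sub_eq_mul_apply_inr (φ : space hN) (j : I) (x y : G) :
    φ.1 (Sum.inl (j, x)) - φ.1 (Sum.inl (j, y)) =
      √(N j (x⁻¹ * y)) * φ.1 (Sum.inr (j, x, y)) := by
  refine evalCLM_eq_of_basic hN (A := lp.evalCLM ℝ (fun _ : Index I G => ℝ) ∞ (Sum.inl (j, x)) - lp.evalCLM ℝ (fun _ : Index I G => ℝ) ∞ (Sum.inl (j, y)))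
    (B := √(N j (x⁻¹ * y)) • lp.evalCLM ℝ (fun _ : Index I G => ℝ) ∞ (Sum.inr (j, x, y))) (fun g i => ?_) φ
  have h2 : (g⁻¹ * x)⁻¹ * (g⁻¹ * y) = x⁻¹ * y := by group
  simp only [evalCLM_apply, smul_apply, sub_apply, smul_eq_mul, lpAction_apply, translation_inl,
    translation_inr, basic_apply, basicFun, h2]
  split_ifs with h
  · subst h
    have h3 := (N j).abs_sub_le_inv_mul (g⁻¹ * x) (g⁻¹ * y)
    rw [h2] at h3
    rcases eq_or_ne (√(N j (x⁻¹ * y))) 0 with h4 | h4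
    · rw [Real.sqrt_eq_zero (apply_nonneg _ _)] at h4
      rw [h4] at h3 ⊢
      simpa using h3
    · rw [mul_div_cancel₀ _ h4]
  · simp

/-- The evaluation functionals `φ ↦ φ i 1`. -/
noncomputable def evalOne (i : I) : NormedDual (space hN) :=
  .of ((lp.evalCLM ℝ (fun _ : Index I G => ℝ) ∞ (Sum.inl (i, 1))).comp (space hN).subtypeL)

theorem eval_dualAction_evalOne (g : G) (i : I) (φ : space hN) :
    NormedDual.eval φ (dualAction (action hN) g (evalOne hN i)) = φ.1 (Sum.inl (i, g)) := by
  have : NormedDual.eval φ (dualAction (action hN) g (evalOne hN i)) =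
    φ.1 (translation g⁻¹⁻¹ (Sum.inl (i, 1))) := rfl
  rw [this, translation_inl, inv_inv, mul_one]

theorem norm_apply_le (φ : space hN) (t : Index I G) : |φ.1 t| ≤ ‖φ‖ :=
  lp.norm_apply_le_norm ENNReal.top_ne_zero φ.1 t

theorem norm_dualAction_evalOne_le (g : G) (i : I) :
    ‖dualAction (action hN) g (evalOne hN i)‖ ≤ 1 := by
  refine NormedDual.norm_le zero_le_one fun φ => ?_
  rw [eval_dualAction_evalOne, one_mul]
  exact norm_apply_le hN φ _

theorem norm_dualAction_evalOne_sub_le (g : G) (i : I) :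
    ‖dualAction (action hN) g (evalOne hN i) - evalOne hN i‖ ≤ √(N i g) := by
  refine NormedDual.norm_le (Real.sqrt_nonneg _) fun φ => ?_
  have h1 : NormedDual.eval φ (evalOne hN i) = φ.1 (Sum.inl (i, 1)) := rfl
  rw [map_sub, eval_dualAction_evalOne, h1, sub_eq_mul_apply_inr, mul_one, map_inv_eq_map, abs_mul,
    abs_of_nonneg (Real.sqrt_nonneg _)]
  exact mul_le_mul_of_nonneg_left (norm_apply_le hN φ _) (Real.sqrt_nonneg _)

/-- The translates of the evaluation functionals are norming: each evaluation at a point of the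
index set is one of them or a divided difference of two of them. -/
theorem norm_le_of_forall_orbitSpan (φ : space hN) (C : ℝ) (hC : 0 ≤ C)
    (h : ∀ ψ ∈ orbitSpan (dualAction (action hN)) (evalOne hN), ‖ψ‖ ≤ 1 →
      |NormedDual.eval φ ψ| ≤ C) : ‖φ‖ ≤ C := by
  refine lp.norm_le_of_forall_le (f := φ.1) hC fun t => ?_
  rcases t with ⟨i, x⟩ | ⟨i, x, y⟩
  · have h1 := h _ (mem_orbitSpan _ _ x i) (norm_dualAction_evalOne_le hN x i)
    rwa [eval_dualAction_evalOne] at h1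
  · let ψ : NormedDual (space hN) := (√(N i (x⁻¹ * y)))⁻¹ •
      (dualAction (action hN) x (evalOne hN i) - dualAction (action hN) y (evalOne hN i))
    have hψ : ∀ φ : space hN, NormedDual.eval φ ψ = φ.1 (Sum.inr (i, x, y)) := fun φ => by
      rw [apply_inr, map_smul, map_sub, eval_dualAction_evalOne, eval_dualAction_evalOne,
        smul_eq_mul]
    have h1 : ‖ψ‖ ≤ 1 := by
      refine NormedDual.norm_le zero_le_one fun φ => ?_
      rw [hψ, one_mul]
      exact norm_apply_le hN φ _
    have h2 := h ψ (Submodule.smul_mem _ _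
      (Submodule.sub_mem _ (mem_orbitSpan _ _ x i) (mem_orbitSpan _ _ y i))) h1
    rwa [hψ] at h2

section Topology

variable [TopologicalSpace G] (hNc : ∀ i, Continuous (N i))

include hNc

theorem tendsto_sqrt (i : I) : Tendsto (fun g => √(N i g)) (𝓝 1) (𝓝 0) := by
  have h : Continuous fun g => √(N i g) := (hNc i).sqrt
  exact h.tendsto' _ _ (by simp)

theorem tendsto_translate_basic (i : I) :
    Tendsto (fun g => lpAction translation g (basic hN i)) (𝓝 1) (𝓝 (basic hN i)) := by
  refine tendsto_iff_norm_sub_tendsto_zero.2 (squeeze_zero (fun _ => norm_nonneg _)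
    (fun g => norm_translate_basic_sub_le hN i g) ?_)
  simpa using (tendsto_sqrt hNc i).const_mul 2

theorem tendsto_dualAction_evalOne (i : I) :
    Tendsto (fun g => dualAction (action hN) g (evalOne hN i)) (𝓝 1) (𝓝 (evalOne hN i)) :=
  tendsto_iff_norm_sub_tendsto_zero.2 (squeeze_zero (fun _ => norm_nonneg _)
    (fun g => norm_dualAction_evalOne_sub_le hN g i) (tendsto_sqrt hNc i))

theorem isContinuousAction_action [IsTopologicalGroup G] : IsContinuousAction ‹TopologicalSpace G› (action hN) :=
  isContinuousAction_orbitAction (tendsto_translate_basic hN hNc)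

end Topology

/-- If the action on the space is continuous for a group topology on `G`, then so are all the
seminorms `N i`, as `N i g` is a value of the translate by `g` of the basic function. -/
theorem tendsto_of_isContinuousAction {τ : TopologicalSpace G}
    (h : IsContinuousAction τ (action hN)) (i : I) : Tendsto (N i) (𝓝 1) (𝓝 0) := by
  let b : space hN := ⟨basic hN i, self_mem_orbitSpan _ _ i⟩
  have h1 : Continuous fun g : G => (action hN g b).1 (Sum.inl (i, 1)) :=
    ((lp.evalCLM ℝ (fun _ : Index I G => ℝ) ∞ (Sum.inl (i, 1))).continuous.comp
      continuous_subtype_val).comp (h.continuous_orbit b)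
  have h2 : ∀ g, (action hN g b).1 (Sum.inl (i, 1)) = N i g := fun g => by
    have h3 : (action hN g b).1 (Sum.inl (i, 1)) =
      basicFun N i (translation g⁻¹ (Sum.inl (i, 1))) := rfl
    rw [h3, translation_inl, mul_one]
    simp [basicFun]
  exact (h1.congr h2).tendsto' 1 0 (map_one_eq_zero _)

end HolderSpace

end Construction

/-! ### Existence of the birepresentation and of the minimal group -/

section Existence

open Filter

/-- Every Hausdorff topological group has a t-exact birepresentation in a strong duality of Banach
spaces whose density does not exceed the weight of the group. The seminorms that enter the
construction are indexed by the members of a base of minimal size that contain the identity. -/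
theorem exists_birepresentation (G : Type u) [Group G] [TopologicalSpace G]
    [IsTopologicalGroup G] :
    ∃ (E F : Type u) (_ : NormedAddCommGroup E) (_ : NormedSpace ℝ E) (_ : CompleteSpace E)
      (_ : NormedAddCommGroup F) (_ : NormedSpace ℝ F) (_ : CompleteSpace F)
      (ω : E →L[ℝ] F →L[ℝ] ℝ) (Ψ : Birepresentation G ω),
      IsRegularForm ω ∧ IsStrongDuality ω ∧ Ψ.IsTExact ∧
      max (density E) (density F) ≤ weight G := by
  obtain ⟨B, hB, hBκ⟩ := exists_isTopologicalBasis_mk_le_weight G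
  let I : Type u := {U : B // (1 : G) ∈ (U : Set G)}
  choose N hNc hN ε hε hNU using fun i : I =>
    exists_groupSeminorm_of_mem_nhds ((hB.isOpen i.1.2).mem_nhds i.2)
  have hI : #I ≤ weight G := (mk_subtype_le _).trans hBκ
  have hv := HolderSpace.tendsto_translate_basic hN hNc
  have hw := HolderSpace.tendsto_dualAction_evalOne hN hNc
  have hρ := HolderSpace.isContinuousAction_action hN hNc
  have hmem : ∀ U ∈ 𝓝 (1 : G), ∃ i : I, ∀ g, N i g < ε i → g ∈ U := fun U hU => by
    obtain ⟨V, hVB, hV1, hVU⟩ := hB.mem_nhds_iff.1 hU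
    exact ⟨⟨⟨V, hVB⟩, hV1⟩, fun g hg => hVU (hNU _ g hg)⟩
  refine ⟨HolderSpace.space hN, orbitSpan (dualAction (HolderSpace.action hN))
    (HolderSpace.evalOne hN), inferInstance, inferInstance,
    (isClosed_orbitSpan _ _).completeSpace_coe, inferInstance, inferInstance,
    (isClosed_orbitSpan _ _).completeSpace_coe, dualPairing _, dualBirepresentation hρ hw,
    isRegularForm_dualPairing _,
    isStrongDuality_dualPairing (HolderSpace.norm_le_of_forall_orbitSpan hN), ?_,
    max_le (density_orbitSpan_le hv density_le_weight hI)
      (density_orbitSpan_le hw density_le_weight hI)⟩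
  intro τ' hτ' hle h1 _
  refine IsTopologicalGroup.ext hτ' inferInstance (le_antisymm ?_ (nhds_mono hle))
  intro U hU
  obtain ⟨i, hi⟩ := hmem U hU
  filter_upwards [(HolderSpace.tendsto_of_isContinuousAction hN h1 i).eventually
    (gt_mem_nhds (hε i))] with g hg
  exact hi g hg

end Existence

theorem theorem6p2 (G : Type u) [Group G] [TopologicalSpace G] [IsTopologicalGroup G]
    [T2Space G] :
    ∃ (E F : Type u) (_ : NormedAddCommGroup E) (_ : NormedSpace ℝ E) (_ : CompleteSpace E)
      (_ : NormedAddCommGroup F) (_ : NormedSpace ℝ F) (_ : CompleteSpace F)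
      (ω : E →L[ℝ] F →L[ℝ] ℝ) (Ψ : Birepresentation G ω),
      IsRegularForm ω ∧ IsStrongDuality ω ∧ Ψ.IsTExact ∧
      max (density E) (density F) ≤ weight G ∧
      -- the induced group is minimal and retracts onto `G`
      IsMinimalGroup Ψ.InducedGroup ∧
      IsGroupRetraction Ψ.projection Ψ.inclusion ∧
      -- the kernel of the retraction is `H₊(ω)`; it is minimal, Weil complete and solvable
      (∃ e : HeisenbergPlus ω ≃ₜ* Ψ.projection.ker,
        ∀ h, (e h : Ψ.InducedGroup) = SemidirectProduct.inl h) ∧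
      IsMinimalGroup Ψ.projection.ker ∧
      IsWeilComplete Ψ.projection.ker ∧
      Group.IsSolvable Ψ.projection.ker ∧
      weight Ψ.InducedGroup = weight G ∧
      character Ψ.InducedGroup = character G ∧
      pseudocharacter Ψ.InducedGroup = pseudocharacter G ∧
      (IsRaikovComplete G → IsRaikovComplete Ψ.InducedGroup) ∧
      (IsWeilComplete G → IsWeilComplete Ψ.InducedGroup) ∧
      (Group.IsSolvable G → Group.IsSolvable Ψ.InducedGroup) := by
  obtain ⟨E, F, _, _, _, _, _, _, ω, Ψ, hreg, hω, hΨ, hd⟩ := exists_birepresentation G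
  have hmin := HeisenbergPlus.isMinimalGroup hω
  have hW := HeisenbergPlus.isWeilComplete ω
  have hS := HeisenbergPlus.isSolvable ω
  let e := SemidirectProduct.kerEquiv Ψ.inducedAction
  exact ⟨E, F, _, _, ‹_›, _, _, ‹_›, ω, Ψ, hreg, hω, hΨ, hd,
    Birepresentation.isMinimalGroup_inducedGroup hω hΨ,
    ⟨SemidirectProduct.continuous_right, SemidirectProduct.continuous_inr, fun _ => rfl⟩,
    ⟨e, fun _ => rfl⟩, hmin.congr e, hW.congr e,
    Group.isSolvable_of_surjective (f := e.toMulEquiv.toMonoidHom) e.surjective,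
    Ψ.weight_inducedGroup hd, Ψ.character_inducedGroup, Ψ.pseudocharacter_inducedGroup,
    SemidirectProduct.isRaikovComplete hW, SemidirectProduct.isWeilComplete hW,
    fun _ => SemidirectProduct.isSolvable⟩
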